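/- Let $N$ be a Poisson random measure on $\mathbb R_+\times\mathbb R_+$ with intensity $dt\,d\theta$ on a probability space $(\Omega,\mathcal F,\mathbb P)$ (so $N(\omega)=\sum_i\delta_{(t_i,\theta_i)}$ is locally finite, with positive and pairwise distinct times $t_i$), and let $\mathbb F^N=(\mathcal F^N_t)_{t\ge 0}$ be its natural history, $\mathcal F^N_t=\sigma\{N(T\times B):T\in\mathcal B([0,t]),\,B\in\mathcal B(\mathbb R_+)\}$. Let $\mu>0$ and let $\Phi:\mathbb R_+\to\mathbb R_+$ be Borel and integrable with $\|\Phi\|_1=\int_0^\infty\Phi(t)\,dt<1$. For $t\ge 0$ put $$X^{(1)}_t=\int_{(0,t]\times\mathbb R_+}\mathbf 1_{\{\theta_1\le\mu\}}\,N(dv_1,d\theta_1),$$ and for $n\ge 2$ $$X^{(n)}_t=\int_{(0,t]\times\mathbb R_+}\int_{(0,v_n)\times\mathbb R_+}\cdots\int_{(0,v_2)\times\mathbb R_+}\mathbf 1_{\{\theta_1\le\mu\}}\prod_{i=2}^n\mathbf 1_{\{\theta_i\le\Phi(v_i-v_{i-1})\}}\,N(dv_1,d\theta_1)\cdots N(dv_n,d\theta_n).$$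 Set $$X_t=\sum_{n\ge1}X^{(n)}_t,\qquad \ell_t=\mu+\int_{(0,t)}\Phi(t-r)\,dX_r,\qquad M_t=X_t-\int_{(0,t)}\ell_u\,du ,$$ where $\ell_t:=\mu$ on the null event $\{\sup_{s<t}X_s=\infty\}$. Let $\mathbb F^X=(\mathcal F^X_t)_{t\ge0}$, $\mathcal F^X_t=\sigma(X_s,\ s\le t)$. Then: 1. for every $T\ge 0$, $\lim_{p\to\infty}\mathbb E\big[\sup_{t\in[0,T]}|X_t-\sum_{n=1}^pX^{(n)}_t|\big]=0$; 2. almost surely, $X$ is $\mathbb N$-valued, non-decreasing and (right-continuous) piecewise constant, with finitely many jumps on every compact time interval; 3. almost surely, for every $t\ge0$, the integral defining $\ell_t$ converges and $\ell$ is integrable on $(0,t)$; 4. $M$ is an $\mathbb F^N$-martingale; 5. $\mathcal F^X_t\subset\mathcal F^N_t$ for every $t\ge0$, $\ell$ is $\mathbb F^X$-predictable, and $M$ is also an $\mathbb F^X$-martingale; 6. if $\Phi$ is not almost everywhere zero, then $X$ is not a counting process: with positive probability there is a $t$ with $X_t-X_{t-}\ge 2$. -/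

import Mathlib

open Set Filter Topology MeasureTheory ProbabilityTheory
open scoped NNReal ENNReal

noncomputable section

/-- The quadrant `𝕏 = ℝ₊ × ℝ₊` of points `(t, θ)`, as a subset of the plane. -/
def quadrant : Set (ℝ × ℝ) := Ici 0 ×ˢ Ici 0

/-- Configurations on `𝕏`: measures `∑ δ_{x_i}` whose atoms `x_i = (t_i, θ_i)` form a locally finite
subset of `𝕏` with positive and pairwise distinct times `t_i`. The measure of `A` is the number of
atoms in `A`. -/
def IsConfiguration (m : Measure (ℝ × ℝ)) : Prop :=
  ∃ S : Set (ℝ × ℝ), S ⊆ quadrant ∧ (∀ b : ℝ, (S ∩ (Icc 0 b ×ˢ Icc 0 b)).Finite) ∧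
    (∀ x ∈ S, 0 < x.1) ∧ InjOn Prod.fst S ∧ m = Measure.count.restrict S

/-- `N` is, under `P`, a Poisson random measure on `𝕏` with intensity `dt dθ`: it takes values in
configurations, its counts are random variables, the count of a set of finite area has the Poisson
law with that area as parameter, and counts of pairwise disjoint sets are independent. -/
structure IsPoissonRandomMeasure {Ω : Type*} [MeasurableSpace Ω] (P : Measure Ω)
    (N : Ω → Measure (ℝ × ℝ)) : Prop where
  configuration : ∀ ω, IsConfiguration (N ω)
  measurable_count : ∀ A : Set (ℝ × ℝ), MeasurableSet A → Measurable fun ω => N ω A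
  poisson_count : ∀ A : Set (ℝ × ℝ), MeasurableSet A → A ⊆ quadrant → volume A ≠ ∞ →
    P.map (fun ω => N ω A) = (poissonMeasure (volume A).toNNReal).map (fun k : ℕ => (k : ℝ≥0∞))
  independent_counts : ∀ (k : ℕ) (A : Fin k → Set (ℝ × ℝ)), (∀ i, MeasurableSet (A i)) →
    Pairwise (fun i j => Disjoint (A i) (A j)) → iIndepFun (fun i ω => N ω (A i)) P

/-- The natural history `𝔽^N` of `N`:
`𝓕_t^N = σ(N(T × B) : T ∈ 𝓑([0,t]), B ∈ 𝓑(ℝ₊))`. -/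
def poissonHistory {Ω : Type*} [mΩ : MeasurableSpace Ω] (N : Ω → Measure (ℝ × ℝ))
    (hN : ∀ A : Set (ℝ × ℝ), MeasurableSet A → Measurable fun ω => N ω A) :
    Filtration ℝ≥0 mΩ where
  seq t := ⨆ (T : Set ℝ) (B : Set ℝ) (_ : MeasurableSet T ∧ T ⊆ Icc 0 (t : ℝ))
    (_ : MeasurableSet B ∧ B ⊆ Ici 0),
    MeasurableSpace.comap (fun ω => N ω (T ×ˢ B)) inferInstance
  mono' := by
    intro s t hst
    refine iSup_le fun T => iSup_le fun B => iSup_le fun hT => iSup_le fun hB => ?_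
    have hT' : MeasurableSet T ∧ T ⊆ Icc 0 (t : ℝ) :=
      ⟨hT.1, hT.2.trans (Icc_subset_Icc_right (NNReal.coe_le_coe.2 hst))⟩
    exact le_iSup_of_le T (le_iSup_of_le B (le_iSup_of_le hT' (le_iSup_of_le hB le_rfl)))
  le' := by
    intro t
    refine iSup_le fun T => iSup_le fun B => iSup_le fun hT => iSup_le fun hB => ?_
    exact (hN _ (hT.1.prod hB.1)).comap_le

/-- The kernel `Φ : ℝ₊ → ℝ₊` is (Borel and) integrable with `‖Φ‖₁ < 1`. Only the values of `Φ` on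
`ℝ₊` matter. -/
structure IsSubcriticalKernel (Φ : ℝ → ℝ) : Prop where
  measurable : Measurable Φ
  nonneg : ∀ t, 0 ≤ t → 0 ≤ Φ t
  integrableOn : IntegrableOn Φ (Ici 0)
  integral_lt_one : ∫ t in Ici 0, Φ t < 1

/-- The integrand in the outermost variable `x = (v_n, θ_n)` of the iterated integral defining
generation `n = k + 1`. It is `𝟏{θ₁ ≤ μ}` for generation `1`, and for generation `n ≥ 2` it is
`∫_{(0,v_n) × ℝ₊} ⋯ ∫_{(0,v_2) × ℝ₊} 𝟏{θ₁ ≤ μ} ∏_{i=2}^n 𝟏{θ_i ≤ Φ(v_i - v_{i-1})} m(dx₁) ⋯ m(dx_{n-1})`,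
where each factor of the product is pulled out of the integrals over variables it does not
involve. -/
def lineage (μ : ℝ) (Φ : ℝ → ℝ) (m : Measure (ℝ × ℝ)) : ℕ → ℝ × ℝ → ℝ≥0∞
  | 0 => fun x => {x : ℝ × ℝ | x.2 ≤ μ}.indicator 1 x
  | k + 1 => fun x => ∫⁻ y in Ioo 0 x.1 ×ˢ Ici 0,
      {y : ℝ × ℝ | x.2 ≤ Φ (x.1 - y.1)}.indicator 1 y * lineage μ Φ m k y ∂m

/-- `X_t^{(n)}` for the generation `n = k + 1`, evaluated at the configuration `m`. -/
def generation (μ : ℝ) (Φ : ℝ → ℝ) (m : Measure (ℝ × ℝ)) (k : ℕ) (t : ℝ) : ℝ≥0∞ :=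
  ∫⁻ x in Ioc 0 t ×ˢ Ici 0, lineage μ Φ m k x ∂m

/-- `X_t = ∑_{n ≥ 1} X_t^{(n)}`, evaluated at the configuration `m`, as an extended number. -/
def population (μ : ℝ) (Φ : ℝ → ℝ) (m : Measure (ℝ × ℝ)) (t : ℝ) : ℝ≥0∞ :=
  ∑' k, generation μ Φ m k t

/-- The Lebesgue-Stieltjes measure `dX = ∑_{n ≥ 1} dX^{(n)}` on `(0,∞)`. -/
def populationMeasure (μ : ℝ) (Φ : ℝ → ℝ) (m : Measure (ℝ × ℝ)) : Measure ℝ :=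
  Measure.sum fun k =>
    ((m.withDensity (lineage μ Φ m k)).restrict (Ioi 0 ×ˢ Ici 0)).map Prod.fst

/-- `dX((0,t]) = X_t`, so that `populationMeasure` is the Stieltjes measure of `t ↦ X_t`. -/
theorem populationMeasure_Ioc (μ : ℝ) (Φ : ℝ → ℝ) (m : Measure (ℝ × ℝ)) (t : ℝ) :
    populationMeasure μ Φ m (Ioc 0 t) = population μ Φ m t := by
  rw [populationMeasure, Measure.sum_apply _ measurableSet_Ioc, population]
  refine tsum_congr fun k => ?_
  have hset : Prod.fst ⁻¹' Ioc (0 : ℝ) t ∩ Ioi (0 : ℝ) ×ˢ Ici (0 : ℝ) =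
      Ioc 0 t ×ˢ Ici 0 := by
    ext x
    simp only [mem_inter_iff, mem_preimage, mem_Ioc, mem_prod, mem_Ioi, mem_Ici]
    tauto
  rw [Measure.map_apply measurable_fst measurableSet_Ioc,
    Measure.restrict_apply (measurable_fst measurableSet_Ioc), hset,
    withDensity_apply _ (measurableSet_Ioc.prod measurableSet_Ici), generation]

open Classical in
/-- `ℓ_t = μ + ∫_{(0,t)} Φ(t - r) dX_r`, evaluated at the configuration `m`. On the (null) event
that infinitely many individuals were born before `t` it is given the value `μ`. -/
def selfIntensity (μ : ℝ) (Φ : ℝ → ℝ) (m : Measure (ℝ × ℝ)) (t : ℝ) : ℝ :=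
  if populationMeasure μ Φ m (Ioo 0 t) = ∞ then μ
  else μ + ∫ r in Ioo 0 t, Φ (t - r) ∂(populationMeasure μ Φ m)

/-- `M_t = X_t - ∫_{(0,t)} ℓ_u du`, evaluated at the configuration `m`. -/
def compensatedPopulation (μ : ℝ) (Φ : ℝ → ℝ) (m : Measure (ℝ × ℝ)) (t : ℝ) : ℝ :=
  (population μ Φ m t).toReal - ∫ u in Ioo 0 t, selfIntensity μ Φ m u

/-- A path on `ℝ₊` is piecewise constant (and right-continuous): on every `[0,T]` it only changes
its value at finitely many times `d`, taking the new value at `d` itself. -/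
def IsPiecewiseConstant {α : Type*} (f : ℝ≥0 → α) : Prop :=
  ∀ T : ℝ≥0, ∃ D : Finset ℝ≥0, ∀ s t : ℝ≥0, s ≤ t → t ≤ T → (∀ d ∈ D, d ∉ Ioc s t) → f s = f t

end

/-! A point `(v, θ)` is an immigrant if `θ ≤ μ`, and a child of an earlier point at time `r` if `θ ≤
Φ (v - r)`. Its `lineage` of order `k` counts the chains of `k` parent links that lead to it from an
immigrant. One point may end several chains, so jumps of `X` can exceed one.

The lineage of `(v, θ)` uses only points strictly before `v`, so it is a predictable integrand, and
Campbell's formula `lintegral_predictable` allows `N` to be replaced by `dt dθ` under the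
expectation. That formula is an equality of two measures on predictable sets times marks. It is
checked on a π-system, where it says that a count after time `a` is independent of the history up to
`a` and has its area as mean.

Integrating the mark out of `𝟏{θ ≤ Φ (v - r)}` leaves `Φ (v - r)`. Each generation therefore has
mean at most `‖Φ‖₁` times that of its parents (`lintegral_generation_le`). The geometric series
bounds the mean of `X_t`, so almost surely `X` is finite at all times. The tail of the series
controls the uniform error, and since points carry integer weights, finiteness leaves only finitely
many birth times on a compact interval. The integral defining `ℓ` is then a finite sum.

Summed over all generations, the mark integral of the lineages is exactly `ℓ_v`. Campbell's formula
on `(s, t]` and an event of the past of `s` (`setLIntegral_populationMeasure`) is thus the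
martingale property. As `ℓ_t` is a functional of the births in `(0, t)`, it is predictable for the
history of `X`, and the tower property transfers the martingale.

For the jump, a point with `θ ≤ min μ (Φ (v - r))` and an immigrant at `r < v` is counted in
generations one and two. If almost surely no such point existed, Campbell's formula would force `min
μ Φ`, hence `Φ`, to vanish almost everywhere. -/

/-! ### Random measures as s-finite kernels -/

/-- A kernel all of whose measures are finite is s-finite. -/
theorem isSFiniteKernel_of_forall_isFiniteMeasure {α β : Type*} [MeasurableSpace α]
    [MeasurableSpace β] (κ : Kernel α β) (h : ∀ a, IsFiniteMeasure (κ a)) : IsSFiniteKernel κ := by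
  classical
  -- The parameter space is cut along the integer part of the total mass; on each piece the kernel
  -- is uniformly bounded.
  have hfl : Measurable fun a => ⌊(κ a univ).toNNReal⌋₊ :=
    Nat.measurable_floor.comp (κ.measurable_coe MeasurableSet.univ).ennreal_toNNReal
  have hs : ∀ n : ℕ, MeasurableSet {a | ⌊(κ a univ).toNNReal⌋₊ = n} := fun n =>
    hfl (measurableSet_singleton n)
  let κs : ℕ → Kernel α β := fun n => Kernel.piecewise (hs n) κ 0
  have hfin : ∀ n, IsFiniteKernel (κs n) := by
    intro n
    refine ⟨(n + 1 : ℕ), ENNReal.natCast_lt_top _, fun a => ?_⟩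
    simp only [κs, Kernel.piecewise_apply]
    split_ifs with ha
    · have h1 : (κ a univ).toNNReal < (n : ℝ≥0) + 1 := by
        have := Nat.lt_floor_add_one (κ a univ).toNNReal
        rwa [show ⌊(κ a univ).toNNReal⌋₊ = n from ha] at this
      rw [← ENNReal.coe_toNNReal (measure_ne_top (κ a) univ)]
      exact_mod_cast h1.le
    · simp
  have hsum : κ = Kernel.sum κs := by
    ext a : 1
    rw [Kernel.sum_apply]
    ext s hs'
    rw [Measure.sum_apply _ hs', tsum_eq_single ⌊(κ a univ).toNNReal⌋₊]
    · simp [κs, Kernel.piecewise_apply]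
    · intro n hn
      have : a ∉ {a | ⌊(κ a univ).toNNReal⌋₊ = n} := fun h => hn h.symm
      simp only [κs, Kernel.piecewise_apply, if_neg this]
      simp
  rw [hsum]
  exact Kernel.isSFiniteKernel_sum

/-- The unit square with lower left corner `p`. -/
def unitSquare (p : ℤ × ℤ) : Set (ℝ × ℝ) :=
  Ico (p.1 : ℝ) (p.1 + 1) ×ˢ Ico (p.2 : ℝ) (p.2 + 1)

theorem measurableSet_unitSquare (p : ℤ × ℤ) : MeasurableSet (unitSquare p) :=
  measurableSet_Ico.prod measurableSet_Ico

theorem pairwise_disjoint_unitSquare : Pairwise (Function.onFun Disjoint unitSquare) := by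
  intro p q hpq
  rw [Function.onFun, Set.disjoint_left]
  rintro x ⟨⟨h1, h2⟩, h3, h4⟩ ⟨⟨h5, h6⟩, h7, h8⟩
  refine hpq (Prod.ext ?_ ?_)
  · rw [← Int.floor_eq_iff.2 ⟨h1, h2⟩, ← Int.floor_eq_iff.2 ⟨h5, h6⟩]
  · rw [← Int.floor_eq_iff.2 ⟨h3, h4⟩, ← Int.floor_eq_iff.2 ⟨h7, h8⟩]

theorem iUnion_unitSquare : ⋃ p, unitSquare p = univ := by
  refine eq_univ_of_forall fun x => mem_iUnion.2 ⟨(⌊x.1⌋, ⌊x.2⌋), ?_⟩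
  exact ⟨⟨Int.floor_le _, Int.lt_floor_add_one _⟩, ⟨Int.floor_le _, Int.lt_floor_add_one _⟩⟩

theorem unitSquare_subset (p : ℤ × ℤ) : ∃ b : ℝ, unitSquare p ⊆ Icc (-b) b ×ˢ Icc (-b) b := by
  refine ⟨|(p.1 : ℝ)| + |(p.2 : ℝ)| + 1, ?_⟩
  rintro x ⟨⟨h1, h2⟩, h3, h4⟩
  have := abs_le.1 (le_refl |(p.1 : ℝ)|)
  have := abs_le.1 (le_refl |(p.2 : ℝ)|)
  refine ⟨⟨?_, ?_⟩, ?_, ?_⟩ <;> linarith [abs_nonneg (p.1 : ℝ), abs_nonneg (p.2 : ℝ)]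

/-- A family of measures on the plane which are finite on squares is an s-finite kernel as soon as
the measure of rectangles is measurable. -/
theorem exists_kernel_of_rectangles {α : Type*} [MeasurableSpace α] (ρ : α → Measure (ℝ × ℝ))
    (hfin : ∀ a, ∀ b : ℝ, ρ a (Icc (-b) b ×ˢ Icc (-b) b) ≠ ∞)
    (hmeas : ∀ A B : Set ℝ, MeasurableSet A → MeasurableSet B →
      Measurable fun a => ρ a (A ×ˢ B)) :
    ∃ κ : Kernel α (ℝ × ℝ), IsSFiniteKernel κ ∧ ∀ a, κ a = ρ a := by
  have hfin' : ∀ p a, IsFiniteMeasure ((ρ a).restrict (unitSquare p)) := by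
    intro p a
    obtain ⟨b, hb⟩ := unitSquare_subset p
    exact ⟨by rw [Measure.restrict_apply_univ]; exact (measure_mono hb).trans_lt (hfin a b).lt_top⟩
  have hrect : ∀ p (A B : Set ℝ), MeasurableSet A → MeasurableSet B →
      Measurable fun a => (ρ a).restrict (unitSquare p) (A ×ˢ B) := by
    intro p A B hA hB
    simp only [Measure.restrict_apply (hA.prod hB), unitSquare, Set.prod_inter_prod]
    exact hmeas _ _ (hA.inter measurableSet_Ico) (hB.inter measurableSet_Ico)
  -- The π-λ argument from rectangles needs finite total mass, which holds on each unit square.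
  have hpiece : ∀ p, Measurable fun a => (ρ a).restrict (unitSquare p) := by
    intro p
    have := hfin' p
    refine Measurable.measure_of_isPiSystem generateFrom_prod.symm isPiSystem_prod ?_ ?_
    · rintro _ ⟨A, hA, B, hB, rfl⟩
      exact hrect p A B hA hB
    · rw [← Set.univ_prod_univ]
      exact hrect p _ _ .univ .univ
  let κs : ℤ × ℤ → Kernel α (ℝ × ℝ) := fun p => ⟨_, hpiece p⟩
  have : ∀ p, IsSFiniteKernel (κs p) := fun p =>
    isSFiniteKernel_of_forall_isFiniteMeasure _ (hfin' p)
  refine ⟨Kernel.sum κs, Kernel.isSFiniteKernel_sum, fun a => ?_⟩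
  rw [Kernel.sum_apply]
  change Measure.sum (fun p => (ρ a).restrict (unitSquare p)) = ρ a
  rw [← Measure.restrict_iUnion pairwise_disjoint_unitSquare measurableSet_unitSquare,
    iUnion_unitSquare, Measure.restrict_univ]

section Configuration

variable {m : Measure (ℝ × ℝ)}

theorem configuration_countable {S : Set (ℝ × ℝ)} (hS : S ⊆ quadrant)
    (hfin : ∀ b : ℝ, (S ∩ (Icc 0 b ×ˢ Icc 0 b)).Finite) : S.Countable := by
  have : S ⊆ ⋃ n : ℕ, S ∩ (Icc 0 (n : ℝ) ×ˢ Icc 0 (n : ℝ)) := by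
    intro x hx
    obtain ⟨n, hn⟩ := exists_nat_ge (max x.1 x.2)
    have hq := hS hx
    exact mem_iUnion.2 ⟨n, hx, ⟨hq.1, (le_max_left _ _).trans hn⟩, hq.2, (le_max_right _ _).trans hn⟩
  exact (countable_iUnion fun n : ℕ => (hfin n).countable).mono this

theorem IsConfiguration.ne_top (hm : IsConfiguration m) (b : ℝ) :
    m (Icc (-b) b ×ˢ Icc (-b) b) ≠ ∞ := by
  obtain ⟨S, hS, hfin, -, -, rfl⟩ := hm
  rw [Measure.restrict_apply (measurableSet_Icc.prod measurableSet_Icc)]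
  refine (measure_mono ?_).trans_lt (Measure.count_apply_lt_top.2 (hfin b)) |>.ne
  rintro x ⟨⟨h1, h2⟩, hx⟩
  exact ⟨hx, ⟨(hS hx).1, h1.2⟩, (hS hx).2, h2.2⟩

end Configuration

/-! ### The predictable σ-algebra -/

section Predictable

variable {Ω : Type*} {mΩ : MeasurableSpace Ω}

/-- `ℝ₊ × Ω`, to be equipped with the predictable σ-algebra of the filtration `𝓕`. -/
structure PredictableSpace (𝓕 : Filtration ℝ≥0 mΩ) where
  /-- The time. -/
  time : ℝ≥0
  /-- The scenario. -/
  scenario : Ω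

variable (𝓕 : Filtration ℝ≥0 mΩ)

namespace PredictableSpace

/-- The set `(a, ∞) × A`. -/
def after (a : ℝ≥0) (A : Set Ω) : Set (PredictableSpace 𝓕) := {p | a < p.time ∧ p.scenario ∈ A}

/-- The set `{0} × A`. -/
def initial (A : Set Ω) : Set (PredictableSpace 𝓕) := {p | p.time = 0 ∧ p.scenario ∈ A}

/-- The sets generating the predictable σ-algebra. -/
def rectangles : Set (Set (PredictableSpace 𝓕)) :=
  {s | ∃ A, MeasurableSet[𝓕 0] A ∧ s = initial 𝓕 A} ∪
    {s | ∃ a A, MeasurableSet[𝓕 a] A ∧ s = after 𝓕 a A}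

instance : MeasurableSpace (PredictableSpace 𝓕) := MeasurableSpace.generateFrom (rectangles 𝓕)

variable {𝓕}

theorem measurableSet_after {a : ℝ≥0} {A : Set Ω} (hA : MeasurableSet[𝓕 a] A) :
    MeasurableSet (after 𝓕 a A) :=
  MeasurableSpace.measurableSet_generateFrom (Or.inr ⟨a, A, hA, rfl⟩)

theorem measurableSet_initial {A : Set Ω} (hA : MeasurableSet[𝓕 0] A) :
    MeasurableSet (initial 𝓕 A) :=
  MeasurableSpace.measurableSet_generateFrom (Or.inl ⟨A, hA, rfl⟩)

theorem initial_union_after (A : Set Ω) :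
    initial 𝓕 A ∪ after 𝓕 0 A = {p | p.scenario ∈ A} := by
  ext p
  change (p.time = 0 ∧ p.scenario ∈ A) ∨ (0 < p.time ∧ p.scenario ∈ A) ↔ p.scenario ∈ A
  rw [← or_and_right, pos_iff_ne_zero]
  tauto

variable (𝓕)

/-- The σ-algebra of `PredictableSpace 𝓕` is the predictable σ-algebra. -/
theorem measurable_mk :
    Measurable[𝓕.predictable] fun p : ℝ≥0 × Ω => (⟨p.1, p.2⟩ : PredictableSpace 𝓕) := by
  refine @measurable_generateFrom _ _ 𝓕.predictable _ _ ?_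
  rintro _ (⟨A, hA, rfl⟩ | ⟨a, A, hA, rfl⟩)
  · exact measurableSet_predictable_singleton_bot_prod hA
  · exact measurableSet_predictable_Ioi_prod hA

theorem measurable_time : Measurable (time : PredictableSpace 𝓕 → ℝ≥0) := by
  refine measurable_of_Ioi fun a => ?_
  have : (time : PredictableSpace 𝓕 → ℝ≥0) ⁻¹' Ioi a = after 𝓕 a univ := by
    ext p
    exact (and_iff_left trivial).symm
  rw [this]
  exact measurableSet_after .univ

variable {𝓕} in
/-- A process which is known strictly before the current time is predictable. -/
theorem measurable_iSup_lt {Y : ℝ≥0 → Ω → ℝ≥0∞} (hY : ∀ q, Measurable[𝓕 q] (Y q)) :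
    Measurable fun p : PredictableSpace 𝓕 =>
      ⨆ q : ℚ, ⨆ _ : Real.toNNReal q < p.time, Y (Real.toNNReal q) p.scenario := by
  refine Measurable.iSup fun q => ?_
  refine measurable_of_Ioi fun a => ?_
  have : (fun p : PredictableSpace 𝓕 =>
      ⨆ _ : Real.toNNReal q < p.time, Y (Real.toNNReal q) p.scenario) ⁻¹' Ioi a =
      after 𝓕 (Real.toNNReal q) (Y (Real.toNNReal q) ⁻¹' Ioi a) := by
    ext p
    change a < (⨆ _ : Real.toNNReal q < p.time, Y (Real.toNNReal q) p.scenario) ↔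
      Real.toNNReal q < p.time ∧ a < Y (Real.toNNReal q) p.scenario
    by_cases h : Real.toNNReal q < p.time <;> simp [h]
  rw [this]
  exact measurableSet_after (hY _ measurableSet_Ioi)

/-- The map `((t, ω), s) ↦ (s, ω)`, restricted to `s < t` and extended by `(0, ω)`. -/
noncomputable def past (z : PredictableSpace 𝓕 × ℝ) : PredictableSpace 𝓕 :=
  ⟨if z.2 < (z.1.time : ℝ) then Real.toNNReal z.2 else 0, z.1.scenario⟩

/-- This allows a predictable process to be read at an earlier time `s` while staying predictable in
the current time `t`: if `a < s < t` and the scenario lies in an event of the past of `a`, then `(t,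
ω)` already lies in the same generator. The default time `0` never exceeds `a`, so it creates no
spurious points. -/
theorem measurable_past : Measurable (past 𝓕) := by
  have htime : Measurable fun z : PredictableSpace 𝓕 × ℝ => (past 𝓕 z).time := by
    refine Measurable.ite ?_ measurable_snd.real_toNNReal measurable_const
    exact measurableSet_lt measurable_snd ((measurable_time 𝓕).comp measurable_fst).coe_nnreal_real
  refine measurable_generateFrom ?_
  rintro _ (⟨A, hA, rfl⟩ | ⟨a, A, hA, rfl⟩)
  · have hA' : MeasurableSet {p : PredictableSpace 𝓕 | p.scenario ∈ A} := by
      rw [← initial_union_after]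
      exact (measurableSet_initial hA).union (measurableSet_after hA)
    exact (htime (measurableSet_singleton 0)).inter (measurable_fst hA')
  · have : past 𝓕 ⁻¹' (after 𝓕 a A) =
        (fun z => (past 𝓕 z).time) ⁻¹' Ioi a ∩ Prod.fst ⁻¹' (after 𝓕 a A) := by
      ext z
      change (a < (past 𝓕 z).time ∧ z.1.scenario ∈ A) ↔
        (a < (past 𝓕 z).time ∧ (a < z.1.time ∧ z.1.scenario ∈ A))
      refine and_congr_right fun h => (and_iff_right_of_imp fun _ => ?_).symm
      dsimp only [past] at h
      split_ifs at h with h2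
      · exact (Real.lt_toNNReal_iff_coe_lt.1 h).trans h2
      · exact absurd h not_lt_zero
    rw [this]
    exact (htime measurableSet_Ioi).inter (measurable_fst (measurableSet_after hA))

/-- Generators of the same kind intersect in one of that kind, with the later of the two starting
times. Generators of different kinds are disjoint, and the empty set is itself a generator. -/
theorem isPiSystem_rectangles : IsPiSystem (rectangles 𝓕) := by
  have hempty : (∅ : Set (PredictableSpace 𝓕)) ∈ rectangles 𝓕 :=
    Or.inl ⟨∅, @MeasurableSet.empty _ (𝓕 0), by simp [initial]⟩
  have hdisj : ∀ (a : ℝ≥0) (A B : Set Ω), initial 𝓕 A ∩ after 𝓕 a B = ∅ := by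
    intro a A B
    refine Set.eq_empty_of_forall_notMem fun p hp => ?_
    have h1 : a < p.time := hp.2.1
    rw [show p.time = 0 from hp.1.1] at h1
    exact not_lt_zero h1
  rintro _ (⟨A, hA, rfl⟩ | ⟨a, A, hA, rfl⟩) _ (⟨B, hB, rfl⟩ | ⟨b, B, hB, rfl⟩) -
  · refine Or.inl ⟨A ∩ B, hA.inter hB, ?_⟩
    ext p
    simp only [initial, mem_inter_iff, mem_ofPred_eq]
    tauto
  · rwa [hdisj]
  · rwa [inter_comm, hdisj]
  · refine Or.inr ⟨a ⊔ b, A ∩ B, (𝓕.mono le_sup_left _ hA).inter (𝓕.mono le_sup_right _ hB), ?_⟩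
    ext p
    simp only [after, mem_inter_iff, mem_ofPred_eq, sup_lt_iff]
    tauto

theorem isCountablySpanning_rectangles : IsCountablySpanning (rectangles 𝓕) := by
  refine ⟨fun n => if n = 0 then initial 𝓕 univ else after 𝓕 0 univ, fun n => ?_, ?_⟩
  · by_cases hn : n = 0
    · exact Or.inl ⟨univ, .univ, if_pos hn⟩
    · exact Or.inr ⟨0, univ, .univ, if_neg hn⟩
  · refine eq_univ_of_forall fun p => mem_iUnion.2 ?_
    by_cases h : p.time = 0
    · exact ⟨0, h, trivial⟩
    · exact ⟨1, pos_iff_ne_zero.2 h, trivial⟩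

end PredictableSpace

end Predictable

/-! ### Mean counts and independence of the past -/

/-- The weights satisfy `(n + 1) p (n + 1) = r p n`, so shifting the index turns the mean into `r`
times the total mass. -/
theorem lintegral_natCast_poissonMeasure (r : ℝ≥0) :
    ∫⁻ k : ℕ, (k : ℝ≥0∞) ∂(poissonMeasure r) = r := by
  have hone : ∑' n, poissonMeasure r {n} = 1 := by
    rw [← measure_univ (μ := poissonMeasure r), ← lintegral_one, lintegral_countable']
    simp
  rw [lintegral_countable', tsum_eq_zero_add' ENNReal.summable]
  have hstep : ∀ n : ℕ, ((n + 1 : ℕ) : ℝ≥0∞) * poissonMeasure r {n + 1} =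
      r * poissonMeasure r {n} := by
    intro n
    rw [poissonMeasure_singleton, poissonMeasure_singleton, ← ENNReal.ofReal_natCast,
      ← ENNReal.ofReal_coe_nnreal, ← ENNReal.ofReal_mul (by positivity),
      ← ENNReal.ofReal_mul (by positivity)]
    congr 1
    rw [Nat.factorial_succ]
    push_cast
    field_simp
    ring
  simp_rw [hstep, ENNReal.tsum_mul_left, hone]
  simp

section Poisson

variable {Ω : Type*} {mΩ : MeasurableSpace Ω} {P : Measure Ω} {N : Ω → Measure (ℝ × ℝ)}

namespace IsPoissonRandomMeasure

/-- The mean number of points in a set is its area. -/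
theorem lintegral_count (hN : IsPoissonRandomMeasure P N) {A : Set (ℝ × ℝ)} (hA : MeasurableSet A)
    (hA' : A ⊆ quadrant) (hv : volume A ≠ ∞) : ∫⁻ ω, N ω A ∂P = volume A := by
  have h1 : ∫⁻ ω, N ω A ∂P = ∫⁻ x, x ∂(P.map fun ω => N ω A) :=
    (lintegral_map measurable_id (hN.measurable_count A hA)).symm
  rw [h1, hN.poisson_count A hA hA' hv, lintegral_map (f := fun x => x) measurable_id
    (measurable_of_countable _), lintegral_natCast_poissonMeasure, ENNReal.coe_toNNReal hv]

/-- The counts up to time `a` are independent of the number of points in a set after `a`. -/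
theorem indep_history [IsProbabilityMeasure P] (hN : IsPoissonRandomMeasure P N) (a : ℝ≥0)
    {D : Set (ℝ × ℝ)} (hD : MeasurableSet D) (hDa : D ⊆ Ioi (a : ℝ) ×ˢ univ) :
    Indep (poissonHistory N hN.measurable_count a)
      (MeasurableSpace.comap (fun ω => N ω D) inferInstance) P := by
  classical
  -- `κ` indexes the rectangles generating the history. It suffices to treat finitely many of them
  -- at a time, as the σ-algebras `H s` are directed.
  let κ := {p : Set ℝ × Set ℝ // (MeasurableSet p.1 ∧ p.1 ⊆ Icc 0 (a : ℝ)) ∧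
    MeasurableSet p.2 ∧ p.2 ⊆ Ici 0}
  let A : κ → Set (ℝ × ℝ) := fun p => p.1.1 ×ˢ p.1.2
  have hA : ∀ p, MeasurableSet (A p) := fun p => p.2.1.1.prod p.2.2.1
  let H : Finset κ → MeasurableSpace Ω := fun s =>
    ⨆ i ∈ s, MeasurableSpace.comap (fun ω => N ω (A i)) inferInstance
  have hle : poissonHistory N hN.measurable_count a ≤ ⨆ s, H s := by
    refine iSup_le fun T => iSup_le fun B => iSup_le fun hT => iSup_le fun hB => ?_
    refine le_iSup_of_le {(⟨(T, B), hT, hB⟩ : κ)} ?_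
    exact le_iSup₂_of_le (⟨(T, B), hT, hB⟩ : κ) (Finset.mem_singleton_self _) le_rfl
  refine indep_of_indep_of_le_left ?_ hle
  refine indep_iSup_of_directed_le (fun s => ?_)
    (fun s => iSup₂_le fun i _ => (hN.measurable_count _ (hA i)).comap_le)
    (hN.measurable_count D hD).comap_le ?_
  swap
  · refine Monotone.directed_le fun s t hst => ?_
    exact iSup₂_le fun i hi => le_iSup₂_of_le i (hst hi) le_rfl
  -- Independence is assumed for disjoint sets only, so the finitely many overlapping rectangles are
  -- replaced by the atoms of the partition they generate: `some c` is the atom with membership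
  -- pattern `c`, cut at time `a`, and `none` is `D`.
  let B : Option (s → Bool) → Set (ℝ × ℝ) := fun o => o.elim D fun c =>
    {x | x.1 ≤ a ∧ (fun i : s => decide (x ∈ A i)) = c}
  have hBm : ∀ o, MeasurableSet (B o) := by
    rintro (_ | c)
    · exact hD
    · refine (measurableSet_le measurable_fst measurable_const).inter ?_
      have : Measurable fun x : ℝ × ℝ => fun i : s => decide (x ∈ A i) :=
        measurable_pi_lambda _ fun i => measurable_to_bool (by
          have : (fun x => decide (x ∈ A i)) ⁻¹' {true} = A i := by ext; simp
          rw [this]; exact hA i)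
      exact this (measurableSet_singleton c)
  have hBd : Pairwise fun i j => Disjoint (B i) (B j) := by
    have hDc : ∀ c, Disjoint D (B (some c)) := fun c =>
      Set.disjoint_left.2 fun x hx hx' => absurd (hDa hx).1 (not_lt.2 hx'.1)
    rintro (_ | c) (_ | d) h
    · exact absurd rfl h
    · exact hDc d
    · exact (hDc c).symm
    · exact Set.disjoint_left.2 fun x hx hx' => h (congrArg some (hx.2.symm.trans hx'.2))
  have hind : iIndepFun (fun o ω => N ω (B o)) P := by
    let e := Fintype.equivFin (Option (s → Bool))
    have := hN.independent_counts _ (fun i => B (e.symm i)) (fun i => hBm _)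
      (fun i j hij => hBd (e.symm.injective.ne hij))
    have := this.precomp e.injective
    simpa using this
  have hST : Disjoint (Finset.univ.erase none : Finset (Option (s → Bool))) {none} := by simp
  have hI := hind.indepFun_finset _ _ hST fun o => hN.measurable_count _ (hBm o)
  rw [IndepFun_iff_Indep] at hI
  refine indep_of_indep_of_le_left (indep_of_indep_of_le_right hI ?_) ?_
  · rw [← measurable_iff_comap_le]
    exact (measurable_pi_apply (X := fun _ => ℝ≥0∞)
      (⟨none, by simp⟩ : ({none} : Finset (Option (s → Bool))))).comp (comap_measurable
      fun ω (i : ({none} : Finset (Option (s → Bool)))) => N ω (B i))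
  · refine iSup₂_le fun i hi => ?_
    rw [← measurable_iff_comap_le]
    -- Each rectangle is the disjoint union of the atoms whose pattern contains it, so its count is
    -- a function of the atom counts.
    have hAi : ∀ ω, N ω (A i) = ∑ c : s → Bool, if c ⟨i, hi⟩ then N ω (B (some c)) else 0 := by
      intro ω
      have : A i = ⋃ c ∈ (Finset.univ.filter fun c : s → Bool => c ⟨i, hi⟩ = true), B (some c) := by
        ext x
        simp only [Finset.mem_filter, Finset.mem_univ, true_and, mem_iUnion, exists_prop]
        constructor
        · intro hx
          exact ⟨_, by simpa using hx, (i.2.1.2 hx.1).2, rfl⟩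
        · rintro ⟨c, hc, -, rfl⟩
          simpa using hc
      rw [this, measure_biUnion_finset (fun c _ d _ h => hBd fun h' => h (Option.some.inj h'))
        fun c _ => hBm _, Finset.sum_filter]
    simp_rw [hAi]
    refine Finset.measurable_sum _ fun c _ => ?_
    split_ifs
    · exact (measurable_pi_apply (X := fun _ => ℝ≥0∞)
        (⟨some c, by simp⟩ : (Finset.univ.erase none : Finset (Option (s → Bool))))).comp
        (comap_measurable fun ω (i : (Finset.univ.erase none : Finset (Option (s → Bool)))) =>
          N ω (B i))
    · exact measurable_const

end IsPoissonRandomMeasure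

end Poisson

open PredictableSpace

/-! ### Campbell's formula -/

section Mark

variable {Ω : Type*} {mΩ : MeasurableSpace Ω} (𝓕 : Filtration ℝ≥0 mΩ)

/-- The point of `PredictableSpace 𝓕 × ℝ` given by a time, a scenario and a mark. -/
def markedPoint (ω : Ω) (x : ℝ × ℝ) : PredictableSpace 𝓕 × ℝ := (⟨Real.toNNReal x.1, ω⟩, x.2)

theorem measurable_markedPoint :
    Measurable fun z : Ω × (ℝ × ℝ) => markedPoint 𝓕 z.1 z.2 := by
  refine Measurable.prodMk ?_ (measurable_snd.comp measurable_snd)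
  have ht : Measurable fun z : Ω × (ℝ × ℝ) => Real.toNNReal z.2.1 :=
    (measurable_fst.comp measurable_snd).real_toNNReal
  refine measurable_generateFrom ?_
  rintro _ (⟨A, hA, rfl⟩ | ⟨a, A, hA, rfl⟩)
  · exact (ht (measurableSet_singleton 0)).inter (measurable_fst (𝓕.le _ _ hA))
  · exact (ht measurableSet_Ioi).inter (measurable_fst (𝓕.le _ _ hA))

/-- The measure of `PredictableSpace 𝓕 × ℝ` induced by a random measure on the quadrant. -/
noncomputable def markedMeasure (P : Measure Ω) (κ : Kernel Ω (ℝ × ℝ)) :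
    Measure (PredictableSpace 𝓕 × ℝ) :=
  ((P ⊗ₘ κ).restrict ((univ : Set Ω) ×ˢ (Ioi 0 ×ˢ Ici 0))).map fun z => markedPoint 𝓕 z.1 z.2

variable {𝓕} in
theorem lintegral_markedMeasure (P : Measure Ω) [IsProbabilityMeasure P] (κ : Kernel Ω (ℝ × ℝ))
    [IsSFiniteKernel κ] {H : PredictableSpace 𝓕 × ℝ → ℝ≥0∞} (hH : Measurable H) :
    ∫⁻ z, H z ∂(markedMeasure 𝓕 P κ) =
      ∫⁻ ω, ∫⁻ x in Ioi 0 ×ˢ Ici 0, H (markedPoint 𝓕 ω x) ∂(κ ω) ∂P := by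
  rw [markedMeasure, lintegral_map hH (measurable_markedPoint 𝓕),
    Measure.setLIntegral_compProd (f := fun z => H (markedPoint 𝓕 z.1 z.2))
      (hH.comp (measurable_markedPoint 𝓕)) .univ (measurableSet_Ioi.prod measurableSet_Ici),
    Measure.restrict_univ]

/-- Truncating time and mark at `T` leaves a set of finite area after time `a`, to which the Poisson
law and the independence of the past apply. -/
theorem markedMeasure_apply_rectangle (P : Measure Ω) [IsProbabilityMeasure P]
    (κ : Kernel Ω (ℝ × ℝ)) [IsSFiniteKernel κ] (T : ℕ) {A : Set Ω} {a : ℝ≥0}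
    (hA : MeasurableSet[𝓕 a] A) {B : Set ℝ} (hB : MeasurableSet B) :
    markedMeasure 𝓕 P κ (after 𝓕 a A ×ˢ B ∩ {z | z.1.time ≤ T ∧ z.2 ≤ T}) =
      ∫⁻ ω, A.indicator 1 ω * κ ω (Ioc (a : ℝ) T ×ˢ (B ∩ Icc 0 (T : ℝ))) ∂P := by
  have hT : MeasurableSet {z : PredictableSpace 𝓕 × ℝ | z.1.time ≤ T ∧ z.2 ≤ T} :=
    (measurableSet_le ((measurable_time 𝓕).comp measurable_fst)
      measurable_const).inter (measurableSet_le measurable_snd measurable_const)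
  have hm := ((measurableSet_after hA).prod hB).inter hT
  rw [← lintegral_indicator_one hm, lintegral_markedMeasure _ _ (measurable_one.indicator hm)]
  refine lintegral_congr fun ω => ?_
  have hD : MeasurableSet (Ioc (a : ℝ) T ×ˢ (B ∩ Icc 0 (T : ℝ))) :=
    measurableSet_Ioc.prod (hB.inter measurableSet_Icc)
  rw [← lintegral_indicator_one hD, ← lintegral_const_mul _ (measurable_one.indicator hD),
    ← lintegral_indicator (measurableSet_Ioi.prod measurableSet_Ici)]
  refine lintegral_congr fun x => ?_
  have key : (x ∈ Ioi (0 : ℝ) ×ˢ Ici (0 : ℝ) ∧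
      markedPoint 𝓕 ω x ∈ after 𝓕 a A ×ˢ B ∩ {z | z.1.time ≤ T ∧ z.2 ≤ T}) ↔
      (ω ∈ A ∧ x ∈ Ioc (a : ℝ) T ×ˢ (B ∩ Icc 0 (T : ℝ))) := by
    change ((0 < x.1 ∧ 0 ≤ x.2) ∧ (((a < Real.toNNReal x.1 ∧ ω ∈ A) ∧ x.2 ∈ B) ∧
      (Real.toNNReal x.1 ≤ (T : ℝ≥0) ∧ x.2 ≤ T))) ↔
      (ω ∈ A ∧ ((a : ℝ) < x.1 ∧ x.1 ≤ T) ∧ (x.2 ∈ B ∧ 0 ≤ x.2 ∧ x.2 ≤ T))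
    rw [Real.lt_toNNReal_iff_coe_lt, Real.toNNReal_le_iff_le_coe]
    have : (a : ℝ) < x.1 → 0 < x.1 := fun h => a.2.trans_lt h
    simp only [NNReal.coe_natCast]
    tauto
  by_cases h1 : x ∈ Ioi (0 : ℝ) ×ˢ Ici (0 : ℝ) <;>
  by_cases h2 : markedPoint 𝓕 ω x ∈ after 𝓕 a A ×ˢ B ∩ {z | z.1.time ≤ T ∧ z.2 ≤ T} <;>
  by_cases h3 : ω ∈ A <;>
  by_cases h4 : x ∈ Ioc (a : ℝ) T ×ˢ (B ∩ Icc 0 (T : ℝ)) <;>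
  simp only [Set.indicator_of_mem, Set.indicator_of_notMem, h1, h2, h3, h4, Pi.one_apply,
    not_false_eq_true, mul_one, mul_zero] <;> tauto

theorem markedMeasure_initial (P : Measure Ω) [IsProbabilityMeasure P]
    (κ : Kernel Ω (ℝ × ℝ)) [IsSFiniteKernel κ] {A : Set Ω}
    (hA : MeasurableSet[𝓕 0] A) {B : Set ℝ} (hB : MeasurableSet B) :
    markedMeasure 𝓕 P κ (initial 𝓕 A ×ˢ B) = 0 := by
  have hm := (measurableSet_initial hA).prod hB
  rw [← lintegral_indicator_one hm, lintegral_markedMeasure _ _ (measurable_one.indicator hm)]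
  refine (lintegral_congr fun ω => ?_).trans lintegral_zero
  refine (setLIntegral_congr_fun (measurableSet_Ioi.prod measurableSet_Ici) fun x hx => ?_).trans
    lintegral_zero
  refine Set.indicator_of_notMem (fun h => ?_) _
  have h1 : Real.toNNReal x.1 = 0 := h.1.1
  exact absurd (Real.toNNReal_eq_zero.1 h1) (not_le.2 hx.1)

end Mark

namespace IsPoissonRandomMeasure

variable {Ω : Type*} {mΩ : MeasurableSpace Ω} {P : Measure Ω} {N : Ω → Measure (ℝ × ℝ)}

/-- The natural history of a Poisson random measure. -/
noncomputable abbrev history (hN : IsPoissonRandomMeasure P N) : Filtration ℝ≥0 mΩ :=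
  poissonHistory N hN.measurable_count

/-- A Poisson random measure is an s-finite kernel. -/
theorem exists_kernel (hN : IsPoissonRandomMeasure P N) :
    ∃ κ : Kernel Ω (ℝ × ℝ), IsSFiniteKernel κ ∧ ∀ ω, κ ω = N ω :=
  exists_kernel_of_rectangles N (fun ω b => (hN.configuration ω).ne_top b)
    fun _ _ hA hB => hN.measurable_count _ (hA.prod hB)

/-- The event is known at time `a` and the count concerns times after `a`: the expectation
factorizes, and the mean count is the area. -/
theorem lintegral_indicator_mul_count [IsProbabilityMeasure P] (hN : IsPoissonRandomMeasure P N)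
    {a : ℝ≥0} {A : Set Ω} (hA : MeasurableSet[hN.history a] A) {B : Set ℝ} (hB : MeasurableSet B)
    (T : ℕ) :
    ∫⁻ ω, A.indicator 1 ω * N ω (Ioc (a : ℝ) T ×ˢ (B ∩ Icc 0 (T : ℝ))) ∂P =
      ∫⁻ ω, A.indicator 1 ω * volume (Ioc (a : ℝ) T ×ˢ (B ∩ Icc 0 (T : ℝ))) ∂P := by
  have hD : MeasurableSet (Ioc (a : ℝ) T ×ˢ (B ∩ Icc 0 (T : ℝ))) :=
    measurableSet_Ioc.prod (hB.inter measurableSet_Icc)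
  have hDq : Ioc (a : ℝ) T ×ˢ (B ∩ Icc 0 (T : ℝ)) ⊆ quadrant :=
    Set.prod_mono (fun x hx => (a.2.trans_lt hx.1).le) (fun x hx => hx.2.1)
  have hDv : volume (Ioc (a : ℝ) T ×ˢ (B ∩ Icc 0 (T : ℝ))) ≠ ∞ := by
    rw [Measure.volume_eq_prod, Measure.prod_prod]
    exact ENNReal.mul_ne_top measure_Ioc_lt_top.ne
      (measure_ne_top_of_subset inter_subset_right measure_Icc_lt_top.ne)
  have hind := hN.indep_history a hD (Set.prod_mono (fun x hx => hx.1) (subset_univ _))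
  have hf : Measurable[hN.history a] (A.indicator (1 : Ω → ℝ≥0∞)) := by
    refine Measurable.indicator ?_ hA
    exact @measurable_const _ _ _ (hN.history a) 1
  rw [lintegral_mul_eq_lintegral_mul_lintegral_of_independent_measurableSpace
    (f := A.indicator 1) (hN.history.le a) (hN.measurable_count _ hD).comap_le hind
    hf (comap_measurable _),
    hN.lintegral_count hD hDq hDv, lintegral_mul_const _
      (measurable_one.indicator (hN.history.le a _ hA))]

/-- Both measures vanish on sets at time zero, agree on truncated generators, and are finite on the
exhausting sets `D T`; uniqueness of finite measures on a π-system, applied on each `D T`, gives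
equality. -/
theorem markedMeasure_eq [IsProbabilityMeasure P] (hN : IsPoissonRandomMeasure P N)
    (κ : Kernel Ω (ℝ × ℝ)) [IsSFiniteKernel κ] (hκ : ∀ ω, κ ω = N ω) :
    markedMeasure hN.history P κ =
      markedMeasure hN.history P (Kernel.const Ω (volume : Measure (ℝ × ℝ))) := by
  set Q₁ := markedMeasure hN.history P κ with hQ₁
  set Q₂ := markedMeasure hN.history P (Kernel.const Ω (volume : Measure (ℝ × ℝ))) with hQ₂
  let D : ℕ → Set (PredictableSpace hN.history × ℝ) := fun T => {z | z.1.time ≤ T ∧ z.2 ≤ T}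
  have hD : ∀ T, MeasurableSet (D T) := fun T =>
    (measurableSet_le ((measurable_time _).comp measurable_fst)
      measurable_const).inter (measurableSet_le measurable_snd measurable_const)
  have hrect : ∀ T (a : ℝ≥0) (A : Set Ω) (B : Set ℝ), MeasurableSet[hN.history a] A →
      MeasurableSet B → Q₁ (after hN.history a A ×ˢ B ∩ D T) = Q₂ (after hN.history a A ×ˢ B ∩ D T) := by
    intro T a A B hA hB
    rw [hQ₁, hQ₂, markedMeasure_apply_rectangle _ _ _ _ hA hB,
      markedMeasure_apply_rectangle _ _ _ _ hA hB]
    simp only [hκ, Kernel.const_apply]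
    exact hN.lintegral_indicator_mul_count hA hB T
  have hbot : ∀ (A : Set Ω) (B : Set ℝ), MeasurableSet[hN.history 0] A → MeasurableSet B →
      Q₁ (initial hN.history A ×ˢ B) = 0 ∧ Q₂ (initial hN.history A ×ˢ B) = 0 := fun A B hA hB =>
    ⟨markedMeasure_initial _ _ _ hA hB, markedMeasure_initial _ _ _ hA hB⟩
  have huniv : ∀ T, D T = initial hN.history univ ×ˢ univ ∩ D T ∪
      after hN.history 0 univ ×ˢ univ ∩ D T := by
    intro T
    rw [← union_inter_distrib_right]
    refine (inter_eq_right.2 fun z _ => ?_).symm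
    by_cases h : z.1.time = 0
    · exact Or.inl ⟨⟨h, trivial⟩, trivial⟩
    · exact Or.inr ⟨⟨pos_iff_ne_zero.2 h, trivial⟩, trivial⟩
  have hle : ∀ (Q : Measure (PredictableSpace hN.history × ℝ)) T,
      Q (initial hN.history univ ×ˢ univ) = 0 →
      Q (D T) = Q (after hN.history 0 univ ×ˢ univ ∩ D T) := by
    intro Q T h
    refine le_antisymm ?_ (measure_mono inter_subset_right)
    conv_lhs => rw [huniv T]
    refine (measure_union_le _ _).trans ?_
    rw [measure_mono_null inter_subset_left h, zero_add]
  have htot : ∀ T, Q₁ (D T) = Q₂ (D T) := by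
    intro T
    have h0 := hbot univ univ .univ .univ
    rw [hle Q₁ T h0.1, hle Q₂ T h0.2]
    exact hrect T 0 univ univ .univ .univ
  have hfin : ∀ T, Q₂ (D T) < ∞ := by
    intro T
    rw [hle Q₂ T (hbot univ univ .univ .univ).2, hQ₂]
    refine (markedMeasure_apply_rectangle _ _ _ T .univ .univ).trans_lt ?_
    simp only [indicator_univ, Pi.one_apply, one_mul, Kernel.const_apply, lintegral_const,
      measure_univ, mul_one, univ_inter, Measure.volume_eq_prod, Measure.prod_prod]
    exact ENNReal.mul_lt_top measure_Ioc_lt_top measure_Icc_lt_top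
  refine Measure.ext_of_iUnion_eq_univ (s := D) (eq_univ_of_forall fun z => ?_) fun T => ?_
  · obtain ⟨n, hn⟩ := exists_nat_ge (max (z.1.time : ℝ) z.2)
    refine mem_iUnion.2 ⟨n, ?_, (le_max_right _ _).trans hn⟩
    exact_mod_cast (le_max_left _ _).trans hn
  · have : IsFiniteMeasure (Q₁.restrict (D T)) :=
      ⟨by rw [Measure.restrict_apply_univ, htot]; exact hfin T⟩
    refine ext_of_generate_finite (image2 (· ×ˢ ·) (rectangles hN.history)
      {s : Set ℝ | MeasurableSet s}) ?_ ?_ ?_ ?_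
    · exact (generateFrom_eq_prod rfl MeasurableSpace.generateFrom_measurableSet
        (isCountablySpanning_rectangles _) isCountablySpanning_measurableSet).symm
    · exact (isPiSystem_rectangles _).prod MeasurableSpace.isPiSystem_measurableSet
    · rintro _ ⟨_, ⟨A, hA, rfl⟩ | ⟨a, A, hA, rfl⟩, B, hB, rfl⟩
      · dsimp only
        rw [Measure.restrict_apply' (hD T), Measure.restrict_apply' (hD T)]
        have := hbot A B hA hB
        rw [measure_mono_null inter_subset_left this.1, measure_mono_null inter_subset_left this.2]
      · dsimp only
        rw [Measure.restrict_apply' (hD T), Measure.restrict_apply' (hD T)]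
        exact hrect T a A B hA hB
    · rw [Measure.restrict_apply_univ, Measure.restrict_apply_univ, htot]

/-- **Campbell's formula** for predictable integrands. -/
theorem lintegral_predictable [IsProbabilityMeasure P] (hN : IsPoissonRandomMeasure P N)
    {H : PredictableSpace hN.history × ℝ → ℝ≥0∞} (hH : Measurable H) :
    ∫⁻ ω, ∫⁻ x in Ioi 0 ×ˢ Ici 0, H (markedPoint hN.history ω x) ∂(N ω) ∂P =
      ∫⁻ ω, (∫⁻ x in Ioi 0 ×ˢ Ici 0, H (markedPoint hN.history ω x)) ∂P := by
  obtain ⟨κ, hκs, hκ⟩ := hN.exists_kernel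
  have := lintegral_markedMeasure P κ hH
  rw [hN.markedMeasure_eq κ hκ, lintegral_markedMeasure P _ hH] at this
  simpa only [hκ, Kernel.const_apply] using this.symm

end IsPoissonRandomMeasure

/-! ### Measurability of lineages and generations -/

/-- Exhausting `(0, t)` by `(0, q]` with rational `q < t` puts a count of the strict past into the
form handled by `measurable_iSup_lt`. This is why parents are sought in an open interval. -/
theorem measure_inter_preimage_Ioo_eq_iSup {β : Type*} [MeasurableSpace β] (m : Measure β)
    (g : β → ℝ) (S : Set β) (t : ℝ≥0) :
    m (S ∩ g ⁻¹' Ioo 0 (t : ℝ)) =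
      ⨆ q : ℚ, ⨆ _ : Real.toNNReal q < t, m (S ∩ g ⁻¹' Ioc 0 (Real.toNNReal q : ℝ)) := by
  have hU : S ∩ g ⁻¹' Ioo 0 (t : ℝ) =
      ⋃ q : {q : ℚ // Real.toNNReal q < t}, S ∩ g ⁻¹' Ioc 0 (Real.toNNReal (q : ℚ) : ℝ) := by
    ext x
    simp only [mem_inter_iff, mem_preimage, mem_Ioo, mem_iUnion, mem_Ioc, Subtype.exists]
    constructor
    · rintro ⟨hx, h0, ht⟩
      obtain ⟨q, hq, hqt⟩ := exists_rat_btwn ht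
      have hq0 : (0 : ℝ) < q := h0.trans hq
      have hc : ((Real.toNNReal (q : ℝ) : ℝ≥0) : ℝ) = q := Real.coe_toNNReal _ hq0.le
      refine ⟨q, ?_, hx, h0, ?_⟩
      · rw [← NNReal.coe_lt_coe, hc]; exact hqt
      · rw [hc]; exact hq.le
    · rintro ⟨q, hq, hx, h0, h1⟩
      exact ⟨hx, h0, h1.trans_lt (NNReal.coe_lt_coe.2 hq)⟩
  have hmono : Monotone fun q : {q : ℚ // Real.toNNReal q < t} =>
      S ∩ g ⁻¹' Ioc 0 (Real.toNNReal (q : ℚ) : ℝ) := fun p q hpq =>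
    inter_subset_inter_right _ (preimage_mono (Ioc_subset_Ioc_right (NNReal.coe_le_coe.2
      (Real.toNNReal_le_toNNReal (Rat.cast_le.2 hpq)))))
  rw [hU, hmono.measure_iUnion, iSup_subtype]

/-- The map `(ω, s) ↦ (s ∧ t, ω)` is measurable with respect to the past of `t`. -/
theorem PredictableSpace.measurable_stopped {Ω : Type*} {mΩ : MeasurableSpace Ω}
    (𝓕 : Filtration ℝ≥0 mΩ) (t : ℝ≥0) :
    Measurable[(𝓕 t).prod inferInstance] fun z : Ω × ℝ =>
      (⟨min (Real.toNNReal z.2) t, z.1⟩ : PredictableSpace 𝓕) := by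
  let := 𝓕 t
  have ht : Measurable fun z : Ω × ℝ => min (Real.toNNReal z.2) t :=
    measurable_snd.real_toNNReal.min measurable_const
  refine measurable_generateFrom ?_
  rintro _ (⟨A, hA, rfl⟩ | ⟨a, A, hA, rfl⟩)
  · exact (ht (measurableSet_singleton 0)).inter (measurable_fst (𝓕.mono (zero_le) _ hA))
  · rcases le_total a t with hat | hta
    · exact (ht measurableSet_Ioi).inter (measurable_fst (𝓕.mono hat _ hA))
    · convert MeasurableSet.empty
      refine Set.eq_empty_of_forall_notMem fun z hz => ?_
      exact absurd (hz.1.trans_le (min_le_right _ _)) (not_lt.2 hta)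

namespace IsPoissonRandomMeasure

variable {Ω : Type*} {mΩ : MeasurableSpace Ω} {P : Measure Ω} {N : Ω → Measure (ℝ × ℝ)}

theorem measurable_history (hN : IsPoissonRandomMeasure P N) {t : ℝ≥0} {A B : Set ℝ}
    (hA : MeasurableSet A) (hAt : A ⊆ Icc 0 (t : ℝ)) (hB : MeasurableSet B) (hB0 : B ⊆ Ici 0) :
    Measurable[hN.history t] fun ω => N ω (A ×ˢ B) := by
  rw [measurable_iff_comap_le]
  exact le_iSup_of_le A (le_iSup_of_le B (le_iSup_of_le ⟨hA, hAt⟩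
    (le_iSup_of_le ⟨hB, hB0⟩ le_rfl)))

theorem _root_.MeasureTheory.Measure.restrict_prod_Ici_apply_prod (m : Measure (ℝ × ℝ)) {I A B : Set ℝ} (hA : MeasurableSet A)
    (hB : MeasurableSet B) :
    m.restrict (I ×ˢ Ici 0) (A ×ˢ B) = m ((A ∩ I) ×ˢ (B ∩ Ici 0)) := by
  rw [Measure.restrict_apply (hA.prod hB), prod_inter_prod]

/-- The restriction of `N` to the strict past of the current time is a predictable kernel. -/
theorem exists_pastKernel (hN : IsPoissonRandomMeasure P N) :
    ∃ κ : Kernel (PredictableSpace hN.history) (ℝ × ℝ), IsSFiniteKernel κ ∧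
      ∀ p, κ p = (N p.scenario).restrict (Ioo 0 (p.time : ℝ) ×ˢ Ici 0) := by
  refine exists_kernel_of_rectangles
    (fun p : PredictableSpace hN.history =>
      (N p.scenario).restrict (Ioo 0 (p.time : ℝ) ×ˢ Ici 0)) (fun p b => ?_) fun A B hA hB => ?_
  · exact ((Measure.restrict_apply_le _ _).trans_lt
      ((hN.configuration p.scenario).ne_top b).lt_top).ne
  · have hY : ∀ q : ℝ≥0, Measurable[hN.history q] fun ω =>
        N ω (A ×ˢ (B ∩ Ici 0) ∩ Prod.fst ⁻¹' Ioc 0 (q : ℝ)) := by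
      intro q
      have : A ×ˢ (B ∩ Ici 0) ∩ Prod.fst ⁻¹' Ioc 0 (q : ℝ) =
          (A ∩ Ioc 0 (q : ℝ)) ×ˢ (B ∩ Ici 0) := by
        ext x; simp only [mem_inter_iff, mem_prod, mem_preimage]; tauto
      rw [this]
      exact hN.measurable_history (hA.inter measurableSet_Ioc)
        (inter_subset_right.trans Ioc_subset_Icc_self) (hB.inter measurableSet_Ici)
        inter_subset_right
    convert measurable_iSup_lt hY using 2 with p
    rw [← measure_inter_preimage_Ioo_eq_iSup, Measure.restrict_prod_Ici_apply_prod _ hA hB]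
    congr 1
    ext x; simp only [mem_inter_iff, mem_prod, mem_preimage]; tauto

/-- The restriction of `N` to the past of `t` is a kernel for the history up to `t`. -/
theorem exists_kernel_upTo (hN : IsPoissonRandomMeasure P N) (t : ℝ≥0) :
    ∃ κ : @Kernel Ω (ℝ × ℝ) (hN.history t) _, IsSFiniteKernel κ ∧
      ∀ ω, κ ω = (N ω).restrict (Ioc 0 (t : ℝ) ×ˢ Ici 0) := by
  refine @exists_kernel_of_rectangles Ω (hN.history t)
    (fun ω => (N ω).restrict (Ioc 0 (t : ℝ) ×ˢ Ici 0)) (fun ω b => ?_) fun A B hA hB => ?_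
  · exact ((Measure.restrict_apply_le _ _).trans_lt ((hN.configuration ω).ne_top b).lt_top).ne
  · simp only [Measure.restrict_prod_Ici_apply_prod _ hA hB]
    exact hN.measurable_history (hA.inter measurableSet_Ioc)
      (inter_subset_right.trans Ioc_subset_Icc_self) (hB.inter measurableSet_Ici) inter_subset_right

variable {μ : ℝ} {Φ : ℝ → ℝ}

variable (μ Φ) in
/-- The process `lineage`, as a function on `PredictableSpace`. -/
noncomputable def predictableLineage (hN : IsPoissonRandomMeasure P N) (k : ℕ)
    (z : PredictableSpace hN.history × ℝ) : ℝ≥0∞ :=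
  lineage μ Φ (N z.1.scenario) k (z.1.time, z.2)

theorem predictableLineage_markedPoint (hN : IsPoissonRandomMeasure P N) (k : ℕ) (ω : Ω)
    {x : ℝ × ℝ} (hx : 0 ≤ x.1) :
    hN.predictableLineage μ Φ k (markedPoint hN.history ω x) = lineage μ Φ (N ω) k x := by
  simp only [predictableLineage, markedPoint, Real.coe_toNNReal _ hx]

theorem measurable_predictableLineage (hN : IsPoissonRandomMeasure P N) (hΦ : Measurable Φ)
    (k : ℕ) : Measurable (hN.predictableLineage μ Φ k) := by
  induction k with
  | zero =>
    exact (measurable_one.indicator (measurableSet_le measurable_snd measurable_const)).comp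
      (((measurable_time _).comp measurable_fst).coe_nnreal_real.prodMk measurable_snd)
  | succ k ih =>
    obtain ⟨κ, hκs, hκ⟩ := hN.exists_pastKernel
    -- The lineage of the parent is evaluated through `past`, which keeps the integrand jointly
    -- measurable for the predictable σ-algebra. On the domain of integration the parent is strictly
    -- earlier, so nothing changes there.
    let f : (PredictableSpace hN.history × ℝ) × (ℝ × ℝ) → ℝ≥0∞ := fun w =>
      {w : (PredictableSpace hN.history × ℝ) × (ℝ × ℝ) |
        w.1.2 ≤ Φ ((w.1.1.time : ℝ) - w.2.1)}.indicator 1 w *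
        hN.predictableLineage μ Φ k (past hN.history (w.1.1, w.2.1), w.2.2)
    have htime : Measurable fun w : (PredictableSpace hN.history × ℝ) × (ℝ × ℝ) =>
        (w.1.1.time : ℝ) := ((measurable_time _).comp
          (measurable_fst.comp measurable_fst)).coe_nnreal_real
    have hf : Measurable f := by
      refine Measurable.mul (measurable_one.indicator (measurableSet_le
        (measurable_snd.comp measurable_fst)
        (hΦ.comp (htime.sub (measurable_fst.comp measurable_snd))))) (ih.comp ?_)
      exact ((measurable_past _).comp ((measurable_fst.comp measurable_fst).prodMk
        (measurable_fst.comp measurable_snd))).prodMk (measurable_snd.comp measurable_snd)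
    have hmain := Measurable.lintegral_kernel_prod_right'
      (κ := κ.comap (Prod.fst : PredictableSpace hN.history × ℝ → _) measurable_fst) hf
    convert hmain using 2 with z
    rw [Kernel.comap_apply, hκ]
    refine setLIntegral_congr_fun (measurableSet_Ioo.prod measurableSet_Ici) fun y hy => ?_
    have hpast : past hN.history (z.1, y.1) = ⟨Real.toNNReal y.1, z.1.scenario⟩ := by
      simp only [past, if_pos hy.1.2]
    simp only [f, hpast]
    congr 1
    exact (hN.predictableLineage_markedPoint k z.1.scenario hy.1.1.le).symm

/-- The number of individuals of a generation is adapted to the history of `N`. -/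
theorem measurable_generation (hN : IsPoissonRandomMeasure P N) (hΦ : Measurable Φ) (k : ℕ)
    (t : ℝ≥0) : Measurable[hN.history t] fun ω => generation μ Φ (N ω) k t := by
  obtain ⟨κ, hκs, hκ⟩ := hN.exists_kernel_upTo t
  let := hN.history t
  -- Capping the time at `t` is invisible on `(0, t]` and makes the integrand measurable for the
  -- history at `t`.
  have hf : Measurable fun w : Ω × (ℝ × ℝ) => hN.predictableLineage μ Φ k
      (⟨min (Real.toNNReal w.2.1) t, w.1⟩, w.2.2) := by
    refine (hN.measurable_predictableLineage hΦ k).comp (Measurable.prodMk ?_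
      (measurable_snd.comp measurable_snd))
    exact (measurable_stopped hN.history t).comp
      (measurable_fst.prodMk (measurable_fst.comp measurable_snd))
  convert Measurable.lintegral_kernel_prod_right' (κ := κ) hf using 2 with ω
  rw [hκ, generation]
  refine setLIntegral_congr_fun (measurableSet_Ioc.prod measurableSet_Ici) fun y hy => ?_
  dsimp only
  rw [min_eq_left (Real.toNNReal_le_iff_le_coe.2 hy.1.2)]
  exact (hN.predictableLineage_markedPoint k ω hy.1.1.le).symm

theorem measurable_population (hN : IsPoissonRandomMeasure P N) (hΦ : Measurable Φ) (t : ℝ≥0) :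
    Measurable[hN.history t] fun ω => population μ Φ (N ω) t := by
  let := hN.history t
  exact Measurable.tsum fun k => hN.measurable_generation hΦ k t

end IsPoissonRandomMeasure

/-! ### Integrating out the marks for a fixed configuration -/

section Pathwise

variable {μ : ℝ} {Φ : ℝ → ℝ} {m : Measure (ℝ × ℝ)}

/-- Here the configuration is frozen, and only measurability in the plane is needed, for Tonelli and
for densities. -/
theorem measurable_lineage [SFinite m] (hΦ : Measurable Φ) (k : ℕ) :
    Measurable (lineage μ Φ m k) := by
  induction k with
  | zero =>
    exact measurable_one.indicator (measurableSet_le measurable_snd measurable_const)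
  | succ k ih =>
    let f : (ℝ × ℝ) × (ℝ × ℝ) → ℝ≥0∞ := fun w =>
      {w : (ℝ × ℝ) × (ℝ × ℝ) | w.2 ∈ Ioo 0 w.1.1 ×ˢ Ici 0}.indicator (fun w =>
        {w : (ℝ × ℝ) × (ℝ × ℝ) | w.1.2 ≤ Φ (w.1.1 - w.2.1)}.indicator 1 w *
          lineage μ Φ m k w.2) w
    have hS : MeasurableSet {w : (ℝ × ℝ) × (ℝ × ℝ) | w.2 ∈ Ioo 0 w.1.1 ×ˢ Ici (0 : ℝ)} := by
      have h1 : MeasurableSet {w : (ℝ × ℝ) × (ℝ × ℝ) | 0 < w.2.1} :=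
        measurableSet_lt measurable_const (by fun_prop)
      have h2 : MeasurableSet {w : (ℝ × ℝ) × (ℝ × ℝ) | w.2.1 < w.1.1} :=
        measurableSet_lt (by fun_prop) (by fun_prop)
      have h3 : MeasurableSet {w : (ℝ × ℝ) × (ℝ × ℝ) | 0 ≤ w.2.2} :=
        measurableSet_le measurable_const (by fun_prop)
      exact (h1.inter h2).inter h3
    have hf : Measurable f := by
      refine Measurable.indicator (Measurable.mul (measurable_one.indicator (measurableSet_le
        (by fun_prop) (hΦ.comp (by fun_prop)))) (ih.comp measurable_snd)) hS
    convert hf.lintegral_prod_right' (ν := m) using 2 with x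
    exact (lintegral_indicator (measurableSet_Ioo.prod measurableSet_Ici) _).symm

variable (μ Φ m) in
/-- The Lebesgue-Stieltjes measure of the births of a generation. -/
noncomputable def generationMeasure (k : ℕ) : Measure ℝ :=
  ((m.withDensity (lineage μ Φ m k)).restrict (Ioi 0 ×ˢ Ici 0)).map Prod.fst

theorem populationMeasure_eq_sum :
    populationMeasure μ Φ m = Measure.sum (generationMeasure μ Φ m) := rfl

instance [SFinite m] (k : ℕ) : SFinite (generationMeasure μ Φ m k) := by
  unfold generationMeasure; infer_instance

instance [SFinite m] : SFinite (populationMeasure μ Φ m) := by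
  rw [populationMeasure_eq_sum]; infer_instance

theorem setLIntegral_generationMeasure [SFinite m] (hΦ : Measurable Φ) (k : ℕ) {I : Set ℝ}
    (hI : MeasurableSet I) (hI0 : I ⊆ Ioi 0) {g : ℝ → ℝ≥0∞} (hg : Measurable g) :
    ∫⁻ r in I, g r ∂(generationMeasure μ Φ m k) =
      ∫⁻ y in I ×ˢ Ici 0, lineage μ Φ m k y * g y.1 ∂m := by
  have hset : Prod.fst ⁻¹' I ∩ Ioi (0 : ℝ) ×ˢ Ici (0 : ℝ) = I ×ˢ Ici 0 := by
    ext x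
    have := @hI0 x.1
    simp only [mem_inter_iff, mem_preimage, mem_prod]
    tauto
  rw [generationMeasure, Measure.restrict_map measurable_fst hI, lintegral_map hg measurable_fst,
    Measure.restrict_restrict (measurable_fst hI), hset,
    restrict_withDensity (hI.prod measurableSet_Ici),
    lintegral_withDensity_eq_lintegral_mul (g := fun y : ℝ × ℝ => g y.1) _
      (measurable_lineage hΦ k) (hg.comp measurable_fst)]
  rfl

theorem generationMeasure_apply [SFinite m] (hΦ : Measurable Φ) (k : ℕ) {I : Set ℝ}
    (hI : MeasurableSet I) (hI0 : I ⊆ Ioi 0) :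
    generationMeasure μ Φ m k I = ∫⁻ y in I ×ˢ Ici 0, lineage μ Φ m k y ∂m := by
  rw [← setLIntegral_one, setLIntegral_generationMeasure (g := fun _ => 1) hΦ k hI hI0 measurable_const]
  simp

theorem populationMeasure_apply [SFinite m] (hΦ : Measurable Φ) {I : Set ℝ}
    (hI : MeasurableSet I) (hI0 : I ⊆ Ioi 0) :
    populationMeasure μ Φ m I = ∑' k, ∫⁻ y in I ×ˢ Ici 0, lineage μ Φ m k y ∂m := by
  rw [populationMeasure_eq_sum, Measure.sum_apply _ hI]
  exact tsum_congr fun k => generationMeasure_apply hΦ k hI hI0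

theorem generationMeasure_Ioc [SFinite m] (hΦ : Measurable Φ) (k : ℕ) (t : ℝ) :
    generationMeasure μ Φ m k (Ioc 0 t) = generation μ Φ m k t :=
  generationMeasure_apply hΦ k measurableSet_Ioc fun _ hx => hx.1

theorem lintegral_indicator_le_eq (b : ℝ) :
    ∫⁻ θ in Ici (0 : ℝ), {θ : ℝ | θ ≤ b}.indicator 1 θ = ENNReal.ofReal b := by
  rw [lintegral_indicator_one (s := {θ : ℝ | θ ≤ b}) measurableSet_Iic,
    Measure.restrict_apply' measurableSet_Ici]
  have : {θ : ℝ | θ ≤ b} ∩ Ici 0 = Icc 0 b := by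
    ext x; simp only [mem_inter_iff, mem_ofPred_eq, mem_Ici, mem_Icc]; tauto
  rw [this, Real.volume_Icc, sub_zero]

theorem lintegral_lineage_zero (v : ℝ) :
    ∫⁻ θ in Ici (0 : ℝ), lineage μ Φ m 0 (v, θ) = ENNReal.ofReal μ :=
  lintegral_indicator_le_eq μ

/-- By Tonelli the mark is integrated first, and a parent at time `r` accepts marks in an interval
of length `Φ (v - r)`. -/
theorem lintegral_lineage_succ [SFinite m] (hΦ : Measurable Φ) (k : ℕ) (v : ℝ) :
    ∫⁻ θ in Ici (0 : ℝ), lineage μ Φ m (k + 1) (v, θ) =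
      ∫⁻ r in Ioo 0 v, ENNReal.ofReal (Φ (v - r)) ∂(generationMeasure μ Φ m k) := by
  rw [setLIntegral_generationMeasure (g := fun r => ENNReal.ofReal (Φ (v - r))) hΦ k
    measurableSet_Ioo (fun _ hx => hx.1) (hΦ.comp (measurable_const.sub measurable_id)).ennreal_ofReal]
  simp only [lineage]
  rw [lintegral_lintegral_swap]
  · refine lintegral_congr fun y => ?_
    have : ∀ θ : ℝ, {y : ℝ × ℝ | θ ≤ Φ (v - y.1)}.indicator (1 : ℝ × ℝ → ℝ≥0∞) y =
        {θ : ℝ | θ ≤ Φ (v - y.1)}.indicator 1 θ := fun θ => rfl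
    simp only [this]
    rw [lintegral_mul_const _ (measurable_one.indicator (s := {θ : ℝ | θ ≤ Φ (v - y.1)})
      measurableSet_Iic), lintegral_indicator_le_eq, mul_comm]
  · refine Measurable.aemeasurable ?_
    have h1 : Measurable fun z : ℝ × (ℝ × ℝ) =>
        {z : ℝ × (ℝ × ℝ) | z.1 ≤ Φ (v - z.2.1)}.indicator (1 : ℝ × (ℝ × ℝ) → ℝ≥0∞) z :=
      measurable_one.indicator (measurableSet_le measurable_fst (hΦ.comp (by fun_prop)))
    exact h1.mul ((measurable_lineage hΦ k).comp measurable_snd)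

variable (μ Φ m) in
/-- The intensity `ℓ`, as an extended nonnegative number. -/
noncomputable def extIntensity (v : ℝ) : ℝ≥0∞ :=
  ENNReal.ofReal μ + ∫⁻ r in Ioo 0 v, ENNReal.ofReal (Φ (v - r)) ∂(populationMeasure μ Φ m)

/-- Immigrants contribute `μ`, and children of generation `k` the convolution with its births. The
sum identifies `ℓ` as the rate of all births together. -/
theorem tsum_lintegral_lineage [SFinite m] (hΦ : Measurable Φ) (v : ℝ) :
    ∑' k, ∫⁻ θ in Ici (0 : ℝ), lineage μ Φ m k (v, θ) = extIntensity μ Φ m v := by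
  rw [tsum_eq_zero_add' ENNReal.summable, lintegral_lineage_zero, extIntensity,
    populationMeasure_eq_sum, Measure.restrict_sum _ measurableSet_Ioo, lintegral_sum_measure]
  simp_rw [lintegral_lineage_succ hΦ]

theorem measurable_setLIntegral_Ioo_sub (ν : Measure ℝ) [SFinite ν] {φ : ℝ → ℝ≥0∞}
    (hφ : Measurable φ) : Measurable fun v => ∫⁻ r in Ioo 0 v, φ (v - r) ∂ν := by
  have hS : MeasurableSet {w : ℝ × ℝ | w.2 ∈ Ioo 0 w.1} :=
    (measurableSet_lt measurable_const measurable_snd).inter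
      (measurableSet_lt measurable_snd measurable_fst)
  have hf : Measurable ({w : ℝ × ℝ | w.2 ∈ Ioo 0 w.1}.indicator fun w => φ (w.1 - w.2)) :=
    (hφ.comp (measurable_fst.sub measurable_snd)).indicator hS
  convert hf.lintegral_prod_right' (ν := ν) using 2 with v
  rw [← lintegral_indicator measurableSet_Ioo]
  rfl

theorem measurable_extIntensity [SFinite m] (hΦ : Measurable Φ) :
    Measurable (extIntensity μ Φ m) :=
  measurable_const.add (measurable_setLIntegral_Ioo_sub _ hΦ.ennreal_ofReal)

/-- Young's identity for the convolution of a function and a measure carried by `(0, ∞)`. -/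
theorem lintegral_Ioo_sub_eq (ν : Measure ℝ) [SFinite ν] {φ : ℝ → ℝ≥0∞} (hφ : Measurable φ) :
    ∫⁻ v in Ioi 0, ∫⁻ r in Ioo 0 v, φ (v - r) ∂ν = (∫⁻ s in Ioi 0, φ s) * ν (Ioi 0) := by
  have hS : MeasurableSet {w : ℝ × ℝ | w.2 ∈ Ioo 0 w.1} :=
    (measurableSet_lt measurable_const measurable_snd).inter
      (measurableSet_lt measurable_snd measurable_fst)
  have hf : Measurable ({w : ℝ × ℝ | w.2 ∈ Ioo 0 w.1}.indicator fun w => φ (w.1 - w.2)) :=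
    (hφ.comp (measurable_fst.sub measurable_snd)).indicator hS
  have h1 : ∀ v, ∫⁻ r in Ioo 0 v, φ (v - r) ∂ν =
      ∫⁻ r, {w : ℝ × ℝ | w.2 ∈ Ioo 0 w.1}.indicator (fun w => φ (w.1 - w.2)) (v, r) ∂ν :=
    fun v => (lintegral_indicator measurableSet_Ioo _).symm
  simp_rw [h1]
  rw [lintegral_lintegral_swap (f := fun v r =>
    {w : ℝ × ℝ | w.2 ∈ Ioo 0 w.1}.indicator (fun w => φ (w.1 - w.2)) (v, r)) hf.aemeasurable,
    ← lintegral_indicator_one measurableSet_Ioi,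
    ← lintegral_const_mul _ (measurable_one.indicator measurableSet_Ioi)]
  refine lintegral_congr fun r => ?_
  by_cases hr : r ∈ Ioi (0 : ℝ)
  · rw [indicator_of_mem hr, Pi.one_apply, mul_one, ← lintegral_indicator measurableSet_Ioi,
      ← lintegral_indicator measurableSet_Ioi,
      ← lintegral_sub_right_eq_self (fun s => (Ioi (0 : ℝ)).indicator (fun s => φ s) s) r]
    refine lintegral_congr fun v => ?_
    by_cases hv : r < v
    · rw [indicator_of_mem (show v ∈ Ioi (0 : ℝ) from lt_trans hr hv),
        indicator_of_mem (show (v, r) ∈ {w : ℝ × ℝ | w.2 ∈ Ioo 0 w.1} from ⟨hr, hv⟩),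
        indicator_of_mem (show v - r ∈ Ioi (0 : ℝ) from sub_pos.2 hv)]
    · rw [indicator_of_notMem (show v - r ∉ Ioi (0 : ℝ) from fun h => hv (sub_pos.1 h))]
      refine indicator_apply_eq_zero.2 fun _ => indicator_of_notMem (fun h => hv h.2) _
  · rw [indicator_of_notMem hr, mul_zero]
    exact (lintegral_congr fun v => indicator_of_notMem (fun h => hr h.1) _).trans lintegral_zero

/-- Young's identity is applied to the restriction of `ν` to `(0, t]`; for `v ≤ t` the inner
integral does not see the restriction. -/
theorem lintegral_Ioo_sub_le (ν : Measure ℝ) [SFinite ν] {φ : ℝ → ℝ≥0∞} (hφ : Measurable φ)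
    (t : ℝ) :
    ∫⁻ v in Ioc 0 t, ∫⁻ r in Ioo 0 v, φ (v - r) ∂ν ≤ (∫⁻ s in Ici 0, φ s) * ν (Ioc 0 t) := by
  have h := lintegral_Ioo_sub_eq (ν.restrict (Ioc 0 t)) hφ
  rw [Measure.restrict_apply measurableSet_Ioi, inter_eq_right.2 Ioc_subset_Ioi_self,
    restrict_Ioi_eq_restrict_Ici] at h
  rw [← h, ← restrict_Ioi_eq_restrict_Ici]
  refine le_trans (le_of_eq (setLIntegral_congr_fun measurableSet_Ioc fun v hv => ?_))
    (lintegral_mono_set Ioc_subset_Ioi_self)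
  rw [Measure.restrict_restrict measurableSet_Ioo, inter_eq_left.2
    (show Ioo 0 v ⊆ Ioc 0 t from fun x hx => ⟨hx.1, hx.2.le.trans hv.2⟩)]

theorem lintegral_volume_prod_Ici {f : ℝ × ℝ → ℝ≥0∞} (hf : Measurable f) (I : Set ℝ) :
    ∫⁻ x in I ×ˢ Ici 0, f x = ∫⁻ v in I, ∫⁻ θ in Ici (0 : ℝ), f (v, θ) := by
  rw [Measure.volume_eq_prod, ← Measure.prod_restrict, lintegral_prod _ hf.aemeasurable]

theorem lintegral_volume_lineage_zero [SFinite m] (hΦ : Measurable Φ) (t : ℝ) :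
    ∫⁻ x in Ioc 0 t ×ˢ Ici 0, lineage μ Φ m 0 x = ENNReal.ofReal μ * ENNReal.ofReal t := by
  rw [lintegral_volume_prod_Ici (measurable_lineage hΦ 0)]
  simp [lintegral_lineage_zero]

theorem lintegral_volume_lineage_succ_le [SFinite m] (hΦ : Measurable Φ) (k : ℕ) (t : ℝ) :
    ∫⁻ x in Ioc 0 t ×ˢ Ici 0, lineage μ Φ m (k + 1) x ≤
      (∫⁻ s in Ici 0, ENNReal.ofReal (Φ s)) * generation μ Φ m k t := by
  rw [lintegral_volume_prod_Ici (measurable_lineage hΦ _),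
    ← generationMeasure_Ioc hΦ k t]
  simp_rw [lintegral_lineage_succ hΦ]
  exact lintegral_Ioo_sub_le _ hΦ.ennreal_ofReal t

theorem lintegral_volume_tsum_lineage [SFinite m] (hΦ : Measurable Φ) (s t : ℝ) :
    ∫⁻ x in Ioc s t ×ˢ Ici 0, ∑' k, lineage μ Φ m k x = ∫⁻ v in Ioc s t, extIntensity μ Φ m v := by
  rw [lintegral_volume_prod_Ici (Measurable.tsum fun k => measurable_lineage hΦ k)]
  refine lintegral_congr fun v => ?_
  rw [lintegral_tsum (f := fun k θ => lineage μ Φ m k (v, θ))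
    fun k => ((measurable_lineage hΦ k).comp measurable_prodMk_left).aemeasurable, tsum_lintegral_lineage hΦ]

end Pathwise

/-! ### Integer values and finitely many birth times -/

/-- An extended nonnegative number which is a natural number or infinite. -/
def IsNatOrTop (a : ℝ≥0∞) : Prop := a = ∞ ∨ ∃ n : ℕ, a = n

theorem IsNatOrTop.one_le {a : ℝ≥0∞} (ha : IsNatOrTop a) (h0 : a ≠ 0) : 1 ≤ a := by
  rcases ha with rfl | ⟨n, rfl⟩
  · exact le_top
  · exact_mod_cast Nat.one_le_iff_ne_zero.2 (by exact_mod_cast h0)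

theorem isNatOrTop_zero : IsNatOrTop 0 := Or.inr ⟨0, by simp⟩

theorem isNatOrTop_one : IsNatOrTop 1 := Or.inr ⟨1, by simp⟩

theorem isNatOrTop_indicator {α : Type*} {f : α → ℝ≥0∞} (A : Set α) (x : α)
    (hf : IsNatOrTop (f x)) : IsNatOrTop (A.indicator f x) := by
  by_cases hx : x ∈ A
  · rwa [indicator_of_mem hx]
  · rw [indicator_of_notMem hx]; exact isNatOrTop_zero

/-- In a convergent series the nonzero terms are at least one, so there are finitely many of them.
-/
theorem isNatOrTop_tsum {ι : Type*} {a : ι → ℝ≥0∞} (ha : ∀ i, IsNatOrTop (a i)) :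
    IsNatOrTop (∑' i, a i) := by
  by_cases h : ∑' i, a i = ∞
  · exact Or.inl h
  have hfin : {i | 1 ≤ a i}.Finite := ENNReal.finite_const_le_of_tsum_ne_top h one_ne_zero
  have hn : ∀ i, ∃ n : ℕ, a i = n := fun i =>
    (ha i).resolve_left (ENNReal.ne_top_of_tsum_ne_top h i)
  choose n hn using hn
  refine Or.inr ⟨∑ i ∈ hfin.toFinset, n i, ?_⟩
  rw [tsum_eq_sum (s := hfin.toFinset)]
  · push_cast
    exact Finset.sum_congr rfl fun i _ => hn i
  · intro i hi
    by_contra h0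
    exact hi (hfin.mem_toFinset.2 ((ha i).one_le h0))

namespace IsConfiguration

variable {m : Measure (ℝ × ℝ)} {μ : ℝ} {Φ : ℝ → ℝ}

theorem sFinite (hm : IsConfiguration m) : SFinite m := by
  have hfin : ∀ p, IsFiniteMeasure (m.restrict (unitSquare p)) := by
    intro p
    obtain ⟨b, hb⟩ := unitSquare_subset p
    exact ⟨by rw [Measure.restrict_apply_univ]; exact (measure_mono hb).trans_lt (hm.ne_top b).lt_top⟩
  have : m = Measure.sum fun p => m.restrict (unitSquare p) := by
    rw [← Measure.restrict_iUnion pairwise_disjoint_unitSquare measurableSet_unitSquare,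
      iUnion_unitSquare, Measure.restrict_univ]
  rw [this]
  infer_instance

/-- Integrals with respect to a configuration are sums over its points. -/
theorem exists_tsum (hm : IsConfiguration m) : ∃ S : Set (ℝ × ℝ),
    ∀ (A : Set (ℝ × ℝ)) (f : ℝ × ℝ → ℝ≥0∞), MeasurableSet A →
      ∫⁻ y in A, f y ∂m = ∑' y : S, A.indicator f y := by
  obtain ⟨S, hS, hfin, -, -, rfl⟩ := hm
  refine ⟨S, fun A f hA => ?_⟩
  rw [← lintegral_indicator hA, lintegral_countable _ (configuration_countable hS hfin)]
  simp

theorem isNatOrTop_setLIntegral (hm : IsConfiguration m) {A : Set (ℝ × ℝ)} (hA : MeasurableSet A)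
    {f : ℝ × ℝ → ℝ≥0∞} (hf : ∀ x, IsNatOrTop (f x)) : IsNatOrTop (∫⁻ y in A, f y ∂m) := by
  obtain ⟨S, hS⟩ := hm.exists_tsum
  rw [hS A f hA]
  exact isNatOrTop_tsum fun x => isNatOrTop_indicator _ _ (hf x)

theorem isNatOrTop_lineage (hm : IsConfiguration m) (k : ℕ) (x : ℝ × ℝ) :
    IsNatOrTop (lineage μ Φ m k x) := by
  induction k generalizing x with
  | zero => exact isNatOrTop_indicator _ _ isNatOrTop_one
  | succ k ih =>
    refine hm.isNatOrTop_setLIntegral (measurableSet_Ioo.prod measurableSet_Ici) fun y => ?_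
    by_cases hy : y ∈ {y : ℝ × ℝ | x.2 ≤ Φ (x.1 - y.1)}
    · rw [indicator_of_mem hy, Pi.one_apply, one_mul]; exact ih y
    · rw [indicator_of_notMem hy, zero_mul]; exact isNatOrTop_zero

theorem isNatOrTop_population (hm : IsConfiguration m) (t : ℝ) :
    IsNatOrTop (population μ Φ m t) :=
  isNatOrTop_tsum fun k => hm.isNatOrTop_setLIntegral (measurableSet_Ioc.prod measurableSet_Ici)
    fun x => hm.isNatOrTop_lineage k x

/-- If the measure of births in `I` is finite, then it is carried by finitely many times. -/
theorem exists_finset_births (hm : IsConfiguration m) (hΦ : Measurable Φ) {I : Set ℝ}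
    (hI : MeasurableSet I) (hI0 : I ⊆ Ioi 0) (h : populationMeasure μ Φ m I ≠ ∞) :
    ∃ D : Finset ℝ, populationMeasure μ Φ m (I \ D) = 0 := by
  have := hm.sFinite
  obtain ⟨S, hS⟩ := hm.exists_tsum
  have hlin : ∀ J : Set ℝ, MeasurableSet J → J ⊆ Ioi 0 → populationMeasure μ Φ m J =
      ∑' x : S, (J ×ˢ Ici 0).indicator (fun x => ∑' k, lineage μ Φ m k x) x := by
    intro J hJ hJ0
    rw [populationMeasure_apply hΦ hJ hJ0, ← hS _ _ (hJ.prod measurableSet_Ici),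
      lintegral_tsum fun k => (measurable_lineage hΦ k).aemeasurable]
  have hnat : ∀ x, IsNatOrTop (∑' k, lineage μ Φ m k x) := fun x =>
    isNatOrTop_tsum fun k => hm.isNatOrTop_lineage k x
  rw [hlin I hI hI0] at h
  -- Every contributing point has total weight at least one, so a finite sum has finitely many
  -- contributing points. Their times form `D`.
  have hfin := ENNReal.finite_const_le_of_tsum_ne_top h one_ne_zero
  classical
  refine ⟨Finset.image (fun x : S => (x : ℝ × ℝ).1) hfin.toFinset, ?_⟩
  rw [hlin _ (hI.diff (Finset.measurableSet _)) (sdiff_subset.trans hI0), ENNReal.tsum_eq_zero]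
  intro x
  by_contra hx
  have hxm := mem_of_indicator_ne_zero hx
  rw [indicator_of_mem hxm] at hx
  refine hxm.1.2 (Finset.mem_coe.2 (Finset.mem_image_of_mem _ (hfin.mem_toFinset.2 ?_)))
  rw [mem_ofPred_eq, indicator_of_mem (show (x : ℝ × ℝ) ∈ I ×ˢ Ici 0 from ⟨hxm.1.1, hxm.2⟩)]
  exact (hnat _).one_le hx

theorem isPiecewiseConstant_population (hm : IsConfiguration m) (hΦ : Measurable Φ)
    (h : ∀ t : ℝ≥0, population μ Φ m t ≠ ∞) :
    IsPiecewiseConstant fun t : ℝ≥0 => population μ Φ m t := by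
  intro T
  have hT := h T
  rw [← populationMeasure_Ioc] at hT
  obtain ⟨D, hD⟩ := hm.exists_finset_births hΦ measurableSet_Ioc (fun x hx => hx.1) hT
  classical
  refine ⟨D.image Real.toNNReal, fun s t hst htT hd => ?_⟩
  dsimp only
  rw [← populationMeasure_Ioc, ← populationMeasure_Ioc,
    ← Ioc_union_Ioc_eq_Ioc s.coe_nonneg (NNReal.coe_le_coe.2 hst), measure_union
      (Set.disjoint_left.2 fun x hx hx' => not_lt.2 hx.2 hx'.1) measurableSet_Ioc]
  have : populationMeasure μ Φ m (Ioc (s : ℝ) t) = 0 := by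
    refine measure_mono_null (t := Ioc 0 (T : ℝ) \ D) (fun x hx =>
      ⟨⟨s.coe_nonneg.trans_lt hx.1, hx.2.trans (NNReal.coe_le_coe.2 htT)⟩, fun hxD => ?_⟩) hD
    have hx0 : (0 : ℝ) ≤ x := s.coe_nonneg.trans hx.1.le
    refine hd _ (Finset.mem_image_of_mem Real.toNNReal (Finset.mem_coe.1 hxD)) ⟨?_, ?_⟩
    · rw [← NNReal.coe_lt_coe, Real.coe_toNNReal _ hx0]; exact hx.1
    · rw [← NNReal.coe_le_coe, Real.coe_toNNReal _ hx0]; exact hx.2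
  rw [this, add_zero]

/-- No bound on `f` is required: the measure is carried by finitely many times, on which any
function is bounded. This is what makes `ℓ` finite even for unbounded `Φ`. -/
theorem integrableOn_populationMeasure (hm : IsConfiguration m) (hΦ : Measurable Φ) {I : Set ℝ}
    (hI : MeasurableSet I) (hI0 : I ⊆ Ioi 0) (h : populationMeasure μ Φ m I ≠ ∞) {f : ℝ → ℝ}
    (hf : Measurable f) : IntegrableOn f I (populationMeasure μ Φ m) := by
  obtain ⟨D, hD⟩ := hm.exists_finset_births hΦ hI hI0 h
  obtain ⟨C, hC⟩ := (D.finite_toSet.image fun x => ‖f x‖).bddAbove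
  refine IntegrableOn.of_bound h.lt_top hf.aestronglyMeasurable C ?_
  rw [ae_restrict_iff' hI]
  refine measure_mono_null (fun x hx => ?_) hD
  simp only [mem_compl_iff, mem_ofPred_eq, Classical.not_imp] at hx
  exact ⟨hx.1, fun hxD => hx.2 (hC (mem_image_of_mem _ hxD))⟩

end IsConfiguration

/-! ### Real and extended versions of the intensity -/

section SelfIntensity

variable {m : Measure (ℝ × ℝ)} {μ : ℝ} {Φ : ℝ → ℝ}

theorem monotone_population : Monotone fun t : ℝ => population μ Φ m t := by
  intro s t hst
  dsimp only
  rw [← populationMeasure_Ioc, ← populationMeasure_Ioc]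
  exact measure_mono (Ioc_subset_Ioc_right hst)

theorem integral_populationMeasure_eq_toReal (hΦ : IsSubcriticalKernel Φ) (t : ℝ) :
    ∫ r in Ioo 0 t, Φ (t - r) ∂(populationMeasure μ Φ m) =
      (∫⁻ r in Ioo 0 t, ENNReal.ofReal (Φ (t - r)) ∂(populationMeasure μ Φ m)).toReal := by
  refine integral_eq_lintegral_of_nonneg_ae ?_
    (hΦ.measurable.comp (measurable_const.sub measurable_id)).aestronglyMeasurable
  filter_upwards [ae_restrict_mem measurableSet_Ioo] with r hr
  exact hΦ.nonneg _ (sub_nonneg.2 hr.2.le)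

/-- With finitely many births before `t` the Bochner integral is not a default value, so the real
intensity and the one valued in `[0, ∞]` coincide. -/
theorem ofReal_selfIntensity (hm : IsConfiguration m) (hμ : 0 ≤ μ) (hΦ : IsSubcriticalKernel Φ)
    {t : ℝ} (h : populationMeasure μ Φ m (Ioo 0 t) ≠ ∞) :
    ENNReal.ofReal (selfIntensity μ Φ m t) = extIntensity μ Φ m t := by
  have hmeas : Measurable fun r => Φ (t - r) :=
    hΦ.measurable.comp (measurable_const.sub measurable_id)
  have hint := hm.integrableOn_populationMeasure hΦ.measurable measurableSet_Ioo
    (fun x hx => hx.1) h hmeas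
  have hfin : ∫⁻ r in Ioo 0 t, ENNReal.ofReal (Φ (t - r)) ∂(populationMeasure μ Φ m) ≠ ∞ := by
    refine ((lintegral_mono fun r => ?_).trans_lt hint.2).ne
    exact Real.ofReal_le_enorm _
  rw [selfIntensity, if_neg h, integral_populationMeasure_eq_toReal hΦ, extIntensity,
    ENNReal.ofReal_add hμ ENNReal.toReal_nonneg, ENNReal.ofReal_toReal hfin]

theorem selfIntensity_nonneg (hμ : 0 ≤ μ) (hΦ : IsSubcriticalKernel Φ) (t : ℝ) :
    0 ≤ selfIntensity μ Φ m t := by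
  unfold selfIntensity
  split_ifs
  · exact hμ
  · rw [integral_populationMeasure_eq_toReal hΦ]
    exact add_nonneg hμ ENNReal.toReal_nonneg

theorem populationMeasure_Ioo_ne_top (h : ∀ t : ℝ≥0, population μ Φ m t ≠ ∞) (t : ℝ) :
    populationMeasure μ Φ m (Ioo 0 t) ≠ ∞ := by
  have := h t.toNNReal
  rw [← populationMeasure_Ioc] at this
  refine ((measure_mono fun x hx => ?_).trans_lt this.lt_top).ne
  exact ⟨hx.1, hx.2.le.trans (Real.le_coe_toNNReal t)⟩

/-- The mass of a subcritical kernel. -/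
theorem IsSubcriticalKernel.lintegral_lt_one (hΦ : IsSubcriticalKernel Φ) :
    ∫⁻ s in Ici 0, ENNReal.ofReal (Φ s) < 1 := by
  rw [← ofReal_integral_eq_lintegral_ofReal hΦ.integrableOn, ← ENNReal.ofReal_one]
  · exact (ENNReal.ofReal_lt_ofReal_iff one_pos).2 hΦ.integral_lt_one
  · filter_upwards [ae_restrict_mem measurableSet_Ici] with s hs
    exact hΦ.nonneg s hs

theorem lintegral_extIntensity_lt_top [SFinite m] (hΦ : IsSubcriticalKernel Φ)
    (h : ∀ t : ℝ≥0, population μ Φ m t ≠ ∞) (t : ℝ≥0) :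
    ∫⁻ v in Ioc 0 (t : ℝ), extIntensity μ Φ m v < ∞ := by
  unfold extIntensity
  rw [lintegral_add_left measurable_const]
  refine ENNReal.add_lt_top.2 ⟨?_, ?_⟩
  · simp [ENNReal.mul_lt_top]
  · refine (lintegral_Ioo_sub_le _ hΦ.measurable.ennreal_ofReal t).trans_lt ?_
    rw [populationMeasure_Ioc]
    exact ENNReal.mul_lt_top (hΦ.lintegral_lt_one.trans ENNReal.one_lt_top) (h t).lt_top

theorem selfIntensity_eq_toReal (hm : IsConfiguration m) (hμ : 0 ≤ μ) (hΦ : IsSubcriticalKernel Φ)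
    (h : ∀ t : ℝ≥0, population μ Φ m t ≠ ∞) :
    selfIntensity μ Φ m = fun t => (extIntensity μ Φ m t).toReal := by
  funext t
  rw [← ofReal_selfIntensity hm hμ hΦ (populationMeasure_Ioo_ne_top h t),
    ENNReal.toReal_ofReal (selfIntensity_nonneg hμ hΦ t)]

theorem integrableOn_selfIntensity (hm : IsConfiguration m) (hμ : 0 ≤ μ)
    (hΦ : IsSubcriticalKernel Φ) (h : ∀ t : ℝ≥0, population μ Φ m t ≠ ∞) (t : ℝ≥0) :
    IntegrableOn (selfIntensity μ Φ m) (Ioo 0 (t : ℝ)) := by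
  have := hm.sFinite
  rw [selfIntensity_eq_toReal hm hμ hΦ h]
  refine integrable_toReal_of_lintegral_ne_top
    (measurable_extIntensity hΦ.measurable).aemeasurable ?_
  exact ((lintegral_mono_set Ioo_subset_Ioc_self).trans_lt
    (lintegral_extIntensity_lt_top hΦ h t)).ne

theorem ofReal_integral_selfIntensity (hm : IsConfiguration m) (hμ : 0 ≤ μ)
    (hΦ : IsSubcriticalKernel Φ) (h : ∀ t : ℝ≥0, population μ Φ m t ≠ ∞) (t : ℝ≥0) :
    ENNReal.ofReal (∫ u in Ioo 0 (t : ℝ), selfIntensity μ Φ m u) =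
      ∫⁻ v in Ioc 0 (t : ℝ), extIntensity μ Φ m v := by
  rw [ofReal_integral_eq_lintegral_ofReal (integrableOn_selfIntensity hm hμ hΦ h t)
    (Eventually.of_forall fun u => selfIntensity_nonneg hμ hΦ u),
    ← restrict_Ioo_eq_restrict_Ioc]
  exact lintegral_congr fun v => ofReal_selfIntensity hm hμ hΦ (populationMeasure_Ioo_ne_top h v)

end SelfIntensity

/-! ### Remainders of the series -/

section PartialSums

variable {m : Measure (ℝ × ℝ)} {μ : ℝ} {Φ : ℝ → ℝ}

theorem monotone_generation (k : ℕ) : Monotone fun t : ℝ => generation μ Φ m k t := fun _ _ hst =>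
  lintegral_mono_set (Set.prod_mono_left (Ioc_subset_Ioc_right hst))

/-- The distance between `X` and its partial sums is controlled by the remainder at the end of the
time interval. -/
theorem iSup_enorm_population_sub_le (h : ∀ t : ℝ≥0, population μ Φ m t ≠ ∞) (T : ℝ≥0) (p : ℕ) :
    ⨆ t ∈ Icc 0 T, ‖(population μ Φ m t).toReal -
      ∑ k ∈ Finset.range p, (generation μ Φ m k t).toReal‖ₑ ≤
      ∑' k, generation μ Φ m (k + p) T := by
  refine iSup₂_le fun t ht => ?_
  have hgen : ∀ k, generation μ Φ m k t ≠ ∞ := ENNReal.ne_top_of_tsum_ne_top (h t)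
  have hsplit : population μ Φ m t = ∑ k ∈ Finset.range p, generation μ Φ m k t +
      ∑' k, generation μ Φ m (k + p) t :=
    (Summable.sum_add_tsum_nat_add' ENNReal.summable).symm
  have htail : ∑' k, generation μ Φ m (k + p) t ≠ ∞ := by
    refine ne_top_of_le_ne_top (h t) ?_
    rw [hsplit]
    exact le_add_self
  rw [hsplit, ENNReal.toReal_add (ENNReal.sum_ne_top.2 fun k _ => hgen k) htail,
    ENNReal.toReal_sum fun k _ => hgen k, add_sub_cancel_left,
    Real.enorm_of_nonneg ENNReal.toReal_nonneg, ENNReal.ofReal_toReal htail]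
  exact ENNReal.tsum_le_tsum fun k => monotone_generation _ (NNReal.coe_le_coe.2 ht.2)

end PartialSums

/-! ### Moment bounds and almost sure finiteness -/

namespace IsPoissonRandomMeasure

variable {Ω : Type*} {mΩ : MeasurableSpace Ω} {P : Measure Ω} [IsProbabilityMeasure P]
  {N : Ω → Measure (ℝ × ℝ)}

/-- **Campbell's formula** on an event of the past. -/
theorem setLIntegral_predictable (hN : IsPoissonRandomMeasure P N)
    {H : PredictableSpace hN.history × ℝ → ℝ≥0∞} (hH : Measurable H) {s : ℝ≥0} {A : Set Ω}
    (hA : MeasurableSet[hN.history s] A) {I : Set ℝ} (hI : MeasurableSet I)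
    (hIs : I ⊆ Ioi (s : ℝ)) :
    ∫⁻ ω in A, (∫⁻ x in I ×ˢ Ici 0, H (markedPoint hN.history ω x) ∂(N ω)) ∂P =
      ∫⁻ ω in A, (∫⁻ x in I ×ˢ Ici 0, H (markedPoint hN.history ω x)) ∂P := by
  -- As `I` lies after `s`, restricting the integrand to times in `I` and scenarios in `A` keeps it
  -- predictable.
  let B : Set (PredictableSpace hN.history × ℝ) := {z | z.1 ∈ after hN.history s A ∧
    (z.1.time : ℝ) ∈ I}
  have hB : MeasurableSet B := (measurable_fst (measurableSet_after hA)).inter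
    (((measurable_time _).comp measurable_fst).coe_nnreal_real hI)
  have key : ∀ (m : Ω → Measure (ℝ × ℝ)) ω, ∫⁻ x in Ioi 0 ×ˢ Ici 0,
      B.indicator H (markedPoint hN.history ω x) ∂(m ω) =
      A.indicator (fun ω => ∫⁻ x in I ×ˢ Ici 0, H (markedPoint hN.history ω x) ∂(m ω)) ω := by
    intro m ω
    have hmem : ∀ x : ℝ × ℝ, x ∈ Ioi (0 : ℝ) ×ˢ Ici (0 : ℝ) →
        (markedPoint hN.history ω x ∈ B ↔ ω ∈ A ∧ x ∈ I ×ˢ Ici (0 : ℝ)) := by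
      intro x hx
      change ((s < Real.toNNReal x.1 ∧ ω ∈ A) ∧ ((Real.toNNReal x.1 : ℝ≥0) : ℝ) ∈ I) ↔ _
      rw [Real.coe_toNNReal _ (le_of_lt hx.1), Real.lt_toNNReal_iff_coe_lt]
      have := @hIs x.1
      exact ⟨fun h => ⟨h.1.2, h.2, hx.2⟩, fun h => ⟨⟨this h.2.1, h.1⟩, h.2.1⟩⟩
    by_cases hω : ω ∈ A
    · rw [indicator_of_mem hω, ← lintegral_indicator (measurableSet_Ioi.prod measurableSet_Ici),
        ← lintegral_indicator (hI.prod measurableSet_Ici)]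
      refine lintegral_congr fun x => ?_
      by_cases hx : x ∈ Ioi (0 : ℝ) ×ˢ Ici (0 : ℝ)
      · rw [indicator_of_mem hx]
        by_cases hxI : x ∈ I ×ˢ Ici (0 : ℝ)
        · rw [indicator_of_mem hxI, indicator_of_mem ((hmem x hx).2 ⟨hω, hxI⟩)]
        · rw [indicator_of_notMem hxI, indicator_of_notMem fun h => hxI ((hmem x hx).1 h).2]
      · rw [indicator_of_notMem hx, indicator_of_notMem]
        exact fun h => hx ⟨s.coe_nonneg.trans_lt (hIs h.1), h.2⟩
    · rw [indicator_of_notMem hω]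
      refine (setLIntegral_congr_fun (measurableSet_Ioi.prod measurableSet_Ici)
        fun x hx => ?_).trans lintegral_zero
      exact indicator_of_notMem (fun h => hω ((hmem x hx).1 h).1) _
  have := hN.lintegral_predictable (hH.indicator hB)
  simp only [key N, key fun _ => volume] at this
  rwa [lintegral_indicator (hN.history.le _ _ hA), lintegral_indicator (hN.history.le _ _ hA)]
    at this

variable {μ : ℝ} {Φ : ℝ → ℝ}

theorem setLIntegral_lineage (hN : IsPoissonRandomMeasure P N) (hΦ : Measurable Φ) (k : ℕ)
    {I : Set ℝ} (hI : MeasurableSet I) (hI0 : I ⊆ Ioi 0) :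
    ∫⁻ ω, (∫⁻ x in I ×ˢ Ici 0, lineage μ Φ (N ω) k x ∂(N ω)) ∂P =
      ∫⁻ ω, (∫⁻ x in I ×ˢ Ici 0, lineage μ Φ (N ω) k x) ∂P := by
  have := hN.setLIntegral_predictable (hN.measurable_predictableLineage (μ := μ) hΦ k) (s := 0)
    .univ hI (by simpa using hI0)
  have key : ∀ (m : Measure (ℝ × ℝ)) ω, ∫⁻ x in I ×ˢ Ici 0,
      hN.predictableLineage μ Φ k (markedPoint hN.history ω x) ∂m =
      ∫⁻ x in I ×ˢ Ici 0, lineage μ Φ (N ω) k x ∂m := fun m ω =>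
    setLIntegral_congr_fun (hI.prod measurableSet_Ici) fun x hx =>
      hN.predictableLineage_markedPoint k ω (le_of_lt (hI0 hx.1))
  simpa only [key, Measure.restrict_univ] using this

/-- Campbell's formula followed by Young's inequality gives the factor `‖Φ‖₁` per generation; the
immigrants have mean `μ t`. -/
theorem lintegral_generation_le (hN : IsPoissonRandomMeasure P N) (hΦ : Measurable Φ) (k : ℕ)
    (t : ℝ≥0) : ∫⁻ ω, generation μ Φ (N ω) k t ∂P ≤
      (∫⁻ s in Ici 0, ENNReal.ofReal (Φ s)) ^ k * (ENNReal.ofReal μ * t) := by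
  have hcamp : ∀ k, ∫⁻ ω, generation μ Φ (N ω) k t ∂P =
      ∫⁻ ω, (∫⁻ x in Ioc 0 (t : ℝ) ×ˢ Ici 0, lineage μ Φ (N ω) k x) ∂P := fun k =>
    hN.setLIntegral_lineage hΦ k measurableSet_Ioc fun _ hx => hx.1
  have hsf : ∀ ω, SFinite (N ω) := fun ω => (hN.configuration ω).sFinite
  induction k with
  | zero =>
    rw [hcamp]
    simp_rw [lintegral_volume_lineage_zero hΦ]
    simp
  | succ k ih =>
    rw [hcamp]
    refine (lintegral_mono fun ω => lintegral_volume_lineage_succ_le hΦ k t).trans ?_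
    rw [lintegral_const_mul _ ((hN.measurable_generation hΦ k t).mono (hN.history.le t) le_rfl),
      pow_succ', mul_assoc]
    gcongr

theorem tsum_lintegral_generation_ne_top (hN : IsPoissonRandomMeasure P N)
    (hΦ : IsSubcriticalKernel Φ) (t : ℝ≥0) :
    ∑' k, ∫⁻ ω, generation μ Φ (N ω) k t ∂P ≠ ∞ := by
  refine ((ENNReal.tsum_le_tsum fun k =>
    hN.lintegral_generation_le hΦ.measurable k t).trans_lt ?_).ne
  rw [ENNReal.tsum_mul_right, ENNReal.tsum_geometric]
  refine ENNReal.mul_lt_top (ENNReal.inv_lt_top.2 (tsub_pos_of_lt hΦ.lintegral_lt_one)) ?_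
  exact ENNReal.mul_lt_top ENNReal.ofReal_lt_top ENNReal.coe_lt_top

theorem lintegral_population_ne_top (hN : IsPoissonRandomMeasure P N)
    (hΦ : IsSubcriticalKernel Φ) (t : ℝ≥0) : ∫⁻ ω, population μ Φ (N ω) t ∂P ≠ ∞ := by
  unfold population
  rw [lintegral_tsum fun k => ((hN.measurable_generation hΦ.measurable k t).mono
    (hN.history.le t) le_rfl).aemeasurable]
  exact hN.tsum_lintegral_generation_ne_top hΦ t

/-- Almost surely, the population is finite at all times. -/
theorem ae_population_ne_top (hN : IsPoissonRandomMeasure P N) (hΦ : IsSubcriticalKernel Φ) :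
    ∀ᵐ ω ∂P, ∀ t : ℝ≥0, population μ Φ (N ω) t ≠ ∞ := by
  have : ∀ n : ℕ, ∀ᵐ ω ∂P, population μ Φ (N ω) (n : ℝ≥0) < ∞ := fun n =>
    ae_lt_top ((hN.measurable_population hΦ.measurable _).mono (hN.history.le _) le_rfl)
      (hN.lintegral_population_ne_top hΦ _)
  filter_upwards [ae_all_iff.2 this] with ω hω t
  obtain ⟨n, hn⟩ := exists_nat_ge t
  exact ((monotone_population (NNReal.coe_le_coe.2 hn)).trans_lt (hω n)).ne

theorem tendsto_lintegral_iSup_population_sub (hN : IsPoissonRandomMeasure P N)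
    (hΦ : IsSubcriticalKernel Φ) (T : ℝ≥0) :
    Tendsto (fun p : ℕ => ∫⁻ ω, ⨆ t ∈ Icc 0 T, ‖(population μ Φ (N ω) t).toReal -
      ∑ k ∈ Finset.range p, (generation μ Φ (N ω) k t).toReal‖ₑ ∂P) atTop (𝓝 0) := by
  refine tendsto_of_tendsto_of_tendsto_of_le_of_le tendsto_const_nhds
    (ENNReal.tendsto_sum_nat_add _ (hN.tsum_lintegral_generation_ne_top (μ := μ) hΦ T))
    (fun _ => zero_le) fun p => ?_
  rw [← lintegral_tsum fun k => ((hN.measurable_generation hΦ.measurable (k + p) T).mono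
    (hN.history.le T) le_rfl).aemeasurable]
  refine lintegral_mono_ae ?_
  filter_upwards [hN.ae_population_ne_top (μ := μ) hΦ] with ω hω
  exact iSup_enorm_population_sub_le hω T p

end IsPoissonRandomMeasure

/-! ### The history of the population and predictability of the intensity -/

/-- The integral of a predictable process up to time `t` is known at time `t`. -/
theorem PredictableSpace.stronglyMeasurable_integral {Ω : Type*} {mΩ : MeasurableSpace Ω}
    {𝓕 : Filtration ℝ≥0 mΩ} {u : PredictableSpace 𝓕 → ℝ} (hu : Measurable u) (t : ℝ≥0) :
    StronglyMeasurable[𝓕 t] fun ω => ∫ s in Ioo 0 (t : ℝ), u ⟨Real.toNNReal s, ω⟩ := by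
  let := 𝓕 t
  have hm : Measurable fun z : Ω × ℝ => u ⟨min (Real.toNNReal z.2) t, z.1⟩ :=
    hu.comp (measurable_stopped 𝓕 t)
  convert hm.stronglyMeasurable.integral_prod_right' (ν := volume.restrict (Ioo 0 (t : ℝ)))
    using 2 with ω
  refine setIntegral_congr_fun measurableSet_Ioo fun s hs => ?_
  dsimp only
  rw [min_eq_left (Real.toNNReal_le_iff_le_coe.2 hs.2.le)]

namespace IsPoissonRandomMeasure

variable {Ω : Type*} {mΩ : MeasurableSpace Ω} {P : Measure Ω} {N : Ω → Measure (ℝ × ℝ)}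
  {μ : ℝ} {Φ : ℝ → ℝ}

variable (μ) in
/-- The natural history of the population. -/
noncomputable def populationHistory (hN : IsPoissonRandomMeasure P N) (hΦ : Measurable Φ) :
    Filtration ℝ≥0 mΩ where
  seq t := ⨆ (s : ℝ≥0) (_ : s ≤ t),
    MeasurableSpace.comap (fun ω => population μ Φ (N ω) s) inferInstance
  mono' := fun _ _ hst => iSup₂_le fun r hr => le_iSup₂_of_le r (hr.trans hst) le_rfl
  le' := fun _ => iSup₂_le fun r _ =>
    ((hN.measurable_population hΦ r).mono (hN.history.le r) le_rfl).comap_le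

theorem populationHistory_le (hN : IsPoissonRandomMeasure P N) (hΦ : Measurable Φ) :
    hN.populationHistory μ hΦ ≤ hN.history := fun _ => iSup₂_le fun r hr =>
  (hN.measurable_population hΦ r).comap_le.trans (hN.history.mono hr)

theorem measurable_population_populationHistory (hN : IsPoissonRandomMeasure P N)
    (hΦ : Measurable Φ) {s t : ℝ≥0} (hst : s ≤ t) :
    Measurable[hN.populationHistory μ hΦ t] fun ω => population μ Φ (N ω) s := by
  rw [measurable_iff_comap_le]
  exact le_iSup₂_of_le s hst le_rfl

/-- Half-lines generate the Borel sets, and a count on `(0, q]` cut at `c` is the value of `X` at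
`min c⁺ q`, known at time `q`. Hence only `X` itself is used, not `N`. -/
theorem measurable_populationMeasure_Iic_inter (hN : IsPoissonRandomMeasure P N)
    (hΦ : Measurable Φ) (c : ℝ) :
    Measurable fun p : PredictableSpace (hN.populationHistory μ hΦ) =>
      populationMeasure μ Φ (N p.scenario) (Iic c ∩ Ioo 0 (p.time : ℝ)) := by
  have hset : ∀ q : ℝ≥0, Iic c ∩ id ⁻¹' Ioc 0 (q : ℝ) = Ioc 0 ((min (Real.toNNReal c) q : ℝ≥0) : ℝ) := by
    intro q
    ext x
    simp only [mem_inter_iff, mem_Iic, mem_preimage, id, mem_Ioc, NNReal.coe_min, le_min_iff,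
      Real.coe_toNNReal', le_max_iff]
    exact ⟨fun h => ⟨h.2.1, Or.inl h.1, h.2.2⟩,
      fun h => ⟨h.2.1.resolve_right (not_le.2 h.1), h.1, h.2.2⟩⟩
  convert measurable_iSup_lt (𝓕 := hN.populationHistory μ hΦ) (Y := fun q ω =>
    population μ Φ (N ω) (min (Real.toNNReal c) q : ℝ≥0)) (fun q =>
      hN.measurable_population_populationHistory hΦ (min_le_right _ q)) using 2 with p
  refine (measure_inter_preimage_Ioo_eq_iSup (populationMeasure μ Φ (N p.scenario)) id
    (Iic c) p.time).trans ?_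
  simp only [hset, populationMeasure_Ioc]

theorem measurable_populationMeasure_Ioo (hN : IsPoissonRandomMeasure P N) (hΦ : Measurable Φ) :
    Measurable fun p : PredictableSpace (hN.populationHistory μ hΦ) =>
      populationMeasure μ Φ (N p.scenario) (Ioo 0 (p.time : ℝ)) := by
  convert measurable_iSup_lt (𝓕 := hN.populationHistory μ hΦ) (Y := fun q ω =>
    population μ Φ (N ω) q) (fun q =>
      hN.measurable_population_populationHistory hΦ le_rfl) using 2 with p
  have := measure_inter_preimage_Ioo_eq_iSup (populationMeasure μ Φ (N p.scenario)) id
    univ p.time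
  simpa only [univ_inter, preimage_id, populationMeasure_Ioc] using this

open Classical in
/-- The births before the current time, as long as there are at most `j` of them, form a
predictable kernel. -/
theorem exists_truncatedKernel (hN : IsPoissonRandomMeasure P N) (hΦ : Measurable Φ) (j : ℕ) :
    ∃ κ : Kernel (PredictableSpace (hN.populationHistory μ hΦ)) ℝ, IsFiniteKernel κ ∧
      ∀ p, κ p = if populationMeasure μ Φ (N p.scenario) (Ioo 0 (p.time : ℝ)) ≤ j then
        (populationMeasure μ Φ (N p.scenario)).restrict (Ioo 0 (p.time : ℝ)) else 0 := by
  let ρ : PredictableSpace (hN.populationHistory μ hΦ) → Measure ℝ := fun p =>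
    if populationMeasure μ Φ (N p.scenario) (Ioo 0 (p.time : ℝ)) ≤ j then
      (populationMeasure μ Φ (N p.scenario)).restrict (Ioo 0 (p.time : ℝ)) else 0
  have hbound : ∀ p, ρ p univ ≤ j := by
    intro p
    simp only [ρ]
    split_ifs with h
    · rwa [Measure.restrict_apply_univ]
    · simp
  have hfin : ∀ p, IsFiniteMeasure (ρ p) := fun p =>
    ⟨(hbound p).trans_lt (ENNReal.natCast_lt_top j)⟩
  have hite : ∀ p A, MeasurableSet A → ρ p A =
      if populationMeasure μ Φ (N p.scenario) (Ioo 0 (p.time : ℝ)) ≤ j then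
        populationMeasure μ Φ (N p.scenario) (A ∩ Ioo 0 (p.time : ℝ)) else 0 := by
    intro p A hA
    simp only [ρ]
    split_ifs
    · rw [Measure.restrict_apply hA]
    · rfl
  have hset := measurableSet_le (hN.measurable_populationMeasure_Ioo (μ := μ) hΦ)
    (measurable_const (a := (j : ℝ≥0∞)))
  have hmeas : Measurable ρ := by
    refine Measurable.measure_of_isPiSystem (borel_eq_generateFrom_Iic ℝ) isPiSystem_Iic ?_ ?_
    · rintro _ ⟨c, rfl⟩
      simp only [hite _ _ measurableSet_Iic]
      exact Measurable.ite hset (hN.measurable_populationMeasure_Iic_inter hΦ c) measurable_const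
    · simp only [hite _ _ .univ, univ_inter]
      exact Measurable.ite hset (hN.measurable_populationMeasure_Ioo hΦ) measurable_const
  exact ⟨⟨ρ, hmeas⟩, ⟨⟨j, ENNReal.natCast_lt_top j, hbound⟩⟩, fun p => rfl⟩

/-- The intensity is predictable for the history of the population. -/
theorem measurable_selfIntensity (hN : IsPoissonRandomMeasure P N) (hΦ : IsSubcriticalKernel Φ) :
    Measurable fun p : PredictableSpace (hN.populationHistory μ hΦ.measurable) =>
      selfIntensity μ Φ (N p.scenario) p.time := by
  choose κ hκf hκ using hN.exists_truncatedKernel (μ := μ) hΦ.measurable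
  have hf : Measurable fun z : PredictableSpace (hN.populationHistory μ hΦ.measurable) × ℝ =>
      ENNReal.ofReal (Φ ((z.1.time : ℝ) - z.2)) :=
    (hΦ.measurable.comp (((measurable_time _).comp measurable_fst).coe_nnreal_real.sub
      measurable_snd)).ennreal_ofReal
  -- The truncated intensities are eventually equal to `ℓ` at each point. If infinitely many births
  -- precede the current time, every truncated kernel is zero and the value is `μ`, which is the
  -- convention for `ℓ`.
  refine measurable_of_tendsto_metrizable (f := fun j p =>
    μ + (∫⁻ r, ENNReal.ofReal (Φ ((p.time : ℝ) - r)) ∂(κ j p)).toReal) (fun j =>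
      measurable_const.add (Measurable.lintegral_kernel_prod_right' (κ := κ j) hf).ennreal_toReal)
    (tendsto_pi_nhds.2 fun p => ?_)
  refine tendsto_const_nhds.congr' ?_
  by_cases h : populationMeasure μ Φ (N p.scenario) (Ioo 0 (p.time : ℝ)) = ∞
  · refine Eventually.of_forall fun j => ?_
    dsimp only
    rw [hκ, if_neg (by simp [h]), selfIntensity, if_pos h]
    simp
  · obtain ⟨n, hn⟩ := ENNReal.exists_nat_gt h
    filter_upwards [eventually_ge_atTop n] with j hj
    rw [hκ, if_pos (hn.le.trans (by exact_mod_cast hj)), selfIntensity, if_neg h,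
      integral_populationMeasure_eq_toReal hΦ]

theorem isStronglyPredictable_selfIntensity (hN : IsPoissonRandomMeasure P N)
    (hΦ : IsSubcriticalKernel Φ) :
    IsStronglyPredictable (hN.populationHistory μ hΦ.measurable)
      fun (t : ℝ≥0) ω => selfIntensity μ Φ (N ω) t := by
  have : Measurable[(hN.populationHistory μ hΦ.measurable).predictable]
      (Function.uncurry fun (t : ℝ≥0) ω => selfIntensity μ Φ (N ω) t) :=
    fun A hA => measurable_mk _ (hN.measurable_selfIntensity hΦ hA)
  exact this.stronglyMeasurable

theorem stronglyMeasurable_integral_selfIntensity (hN : IsPoissonRandomMeasure P N)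
    (hΦ : IsSubcriticalKernel Φ) (t : ℝ≥0) :
    StronglyMeasurable[hN.populationHistory μ hΦ.measurable t] fun ω =>
      ∫ u in Ioo 0 (t : ℝ), selfIntensity μ Φ (N ω) u := by
  convert stronglyMeasurable_integral (hN.measurable_selfIntensity (μ := μ) hΦ) t using 2 with ω
  refine setIntegral_congr_fun measurableSet_Ioo fun u hu => ?_
  dsimp only
  rw [Real.coe_toNNReal _ hu.1.le]

theorem stronglyAdapted_compensatedPopulation (hN : IsPoissonRandomMeasure P N)
    (hΦ : IsSubcriticalKernel Φ) : StronglyAdapted (hN.populationHistory μ hΦ.measurable)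
      fun (t : ℝ≥0) ω => compensatedPopulation μ Φ (N ω) t := fun t =>
  (hN.measurable_population_populationHistory hΦ.measurable
    le_rfl).ennreal_toReal.stronglyMeasurable.sub
      (hN.stronglyMeasurable_integral_selfIntensity hΦ t)

/-! ### The martingale property -/

variable [IsProbabilityMeasure P]

/-- The compensator of the population, as an extended nonnegative number, agrees almost surely with
the integral of the intensity. -/
theorem ae_ofReal_integral_selfIntensity (hN : IsPoissonRandomMeasure P N) (hμ : 0 ≤ μ)
    (hΦ : IsSubcriticalKernel Φ) (t : ℝ≥0) :
    (fun ω => ENNReal.ofReal (∫ u in Ioo 0 (t : ℝ), selfIntensity μ Φ (N ω) u)) =ᵐ[P]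
      fun ω => ∫⁻ v in Ioc 0 (t : ℝ), extIntensity μ Φ (N ω) v := by
  filter_upwards [hN.ae_population_ne_top (μ := μ) hΦ] with ω hω
  exact ofReal_integral_selfIntensity (hN.configuration ω) hμ hΦ hω t

/-- Campbell's formula is applied to the sum of all lineages. It compares the increments of `X` and
of its compensator in `[0, ∞]`, before any subtraction. -/
theorem setLIntegral_populationMeasure (hN : IsPoissonRandomMeasure P N) (hΦ : Measurable Φ)
    {s : ℝ≥0} (t : ℝ≥0) {A : Set Ω} (hA : MeasurableSet[hN.history s] A) :
    ∫⁻ ω in A, populationMeasure μ Φ (N ω) (Ioc (s : ℝ) t) ∂P =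
      ∫⁻ ω in A, (∫⁻ v in Ioc (s : ℝ) t, extIntensity μ Φ (N ω) v) ∂P := by
  have hsf : ∀ ω, SFinite (N ω) := fun ω => (hN.configuration ω).sFinite
  have hH : Measurable fun z => ∑' k, hN.predictableLineage μ Φ k z :=
    Measurable.tsum fun k => hN.measurable_predictableLineage hΦ k
  have h0 : ∀ x ∈ Ioc (s : ℝ) t ×ˢ Ici (0 : ℝ), 0 ≤ x.1 := fun x hx =>
    s.coe_nonneg.trans hx.1.1.le
  have key : ∀ (m : Measure (ℝ × ℝ)) ω, ∫⁻ x in Ioc (s : ℝ) t ×ˢ Ici 0,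
      ∑' k, hN.predictableLineage μ Φ k (markedPoint hN.history ω x) ∂m =
      ∫⁻ x in Ioc (s : ℝ) t ×ˢ Ici 0, ∑' k, lineage μ Φ (N ω) k x ∂m := fun m ω =>
    setLIntegral_congr_fun (measurableSet_Ioc.prod measurableSet_Ici) fun x hx =>
      tsum_congr fun k => hN.predictableLineage_markedPoint k ω (h0 x hx)
  have := hN.setLIntegral_predictable hH hA measurableSet_Ioc
    (fun x (hx : x ∈ Ioc (s : ℝ) t) => hx.1)
  simp only [key] at this
  simp_rw [lintegral_volume_tsum_lineage hΦ] at this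
  rw [← this]
  refine lintegral_congr fun ω => ?_
  rw [populationMeasure_apply hΦ measurableSet_Ioc fun x hx => s.coe_nonneg.trans_lt hx.1,
    lintegral_tsum fun k => (measurable_lineage hΦ k).aemeasurable]

theorem population_add (μ : ℝ) (Φ : ℝ → ℝ) (m : Measure (ℝ × ℝ)) {s t : ℝ≥0} (hst : s ≤ t) :
    population μ Φ m t = population μ Φ m s + populationMeasure μ Φ m (Ioc (s : ℝ) t) := by
  rw [← populationMeasure_Ioc, ← populationMeasure_Ioc,
    ← Ioc_union_Ioc_eq_Ioc s.coe_nonneg (NNReal.coe_le_coe.2 hst), measure_union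
      (Set.disjoint_left.2 fun x hx hx' => not_lt.2 hx.2 hx'.1) measurableSet_Ioc]

theorem lintegral_compensator (hN : IsPoissonRandomMeasure P N) (hΦ : Measurable Φ) (t : ℝ≥0) :
    ∫⁻ ω, (∫⁻ v in Ioc 0 (t : ℝ), extIntensity μ Φ (N ω) v) ∂P =
      ∫⁻ ω, population μ Φ (N ω) t ∂P := by
  have := hN.setLIntegral_populationMeasure (μ := μ) hΦ (s := 0) t .univ
  simpa only [Measure.restrict_univ, NNReal.coe_zero, populationMeasure_Ioc] using this.symm

theorem integrable_population (hN : IsPoissonRandomMeasure P N) (hΦ : IsSubcriticalKernel Φ)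
    (t : ℝ≥0) : Integrable (fun ω => (population μ Φ (N ω) t).toReal) P :=
  integrable_toReal_of_lintegral_ne_top
    ((hN.measurable_population hΦ.measurable t).mono (hN.history.le t) le_rfl).aemeasurable
    (hN.lintegral_population_ne_top hΦ t)

/-- Measurability in the scenario is inherited from the real compensator, whose integrand is
predictable and which agrees almost surely. -/
theorem aemeasurable_compensator (hN : IsPoissonRandomMeasure P N) (hμ : 0 ≤ μ)
    (hΦ : IsSubcriticalKernel Φ) (t : ℝ≥0) :
    AEMeasurable (fun ω => ∫⁻ v in Ioc 0 (t : ℝ), extIntensity μ Φ (N ω) v) P :=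
  AEMeasurable.congr (((hN.stronglyMeasurable_integral_selfIntensity hΦ t).mono
    ((hN.populationHistory μ hΦ.measurable).le t)).measurable.ennreal_ofReal.aemeasurable)
    (hN.ae_ofReal_integral_selfIntensity hμ hΦ t)

theorem ae_integral_selfIntensity (hN : IsPoissonRandomMeasure P N) (hμ : 0 ≤ μ)
    (hΦ : IsSubcriticalKernel Φ) (t : ℝ≥0) :
    (fun ω => (∫⁻ v in Ioc 0 (t : ℝ), extIntensity μ Φ (N ω) v).toReal) =ᵐ[P]
      fun ω => ∫ u in Ioo 0 (t : ℝ), selfIntensity μ Φ (N ω) u := by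
  filter_upwards [hN.ae_ofReal_integral_selfIntensity hμ hΦ t] with ω hω
  rw [← hω, ENNReal.toReal_ofReal (integral_nonneg fun u => selfIntensity_nonneg hμ hΦ u)]

theorem integrable_integral_selfIntensity (hN : IsPoissonRandomMeasure P N) (hμ : 0 ≤ μ)
    (hΦ : IsSubcriticalKernel Φ) (t : ℝ≥0) :
    Integrable (fun ω => ∫ u in Ioo 0 (t : ℝ), selfIntensity μ Φ (N ω) u) P := by
  refine (integrable_toReal_of_lintegral_ne_top (hN.aemeasurable_compensator hμ hΦ t) ?_).congr
    (hN.ae_integral_selfIntensity hμ hΦ t)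
  rw [hN.lintegral_compensator hΦ.measurable]
  exact hN.lintegral_population_ne_top hΦ t

theorem setIntegral_compensatedPopulation (hN : IsPoissonRandomMeasure P N) (hμ : 0 ≤ μ)
    (hΦ : IsSubcriticalKernel Φ) (t : ℝ≥0) (A : Set Ω) :
    ∫ ω in A, compensatedPopulation μ Φ (N ω) t ∂P =
      (∫⁻ ω in A, population μ Φ (N ω) t ∂P).toReal -
        (∫⁻ ω in A, (∫⁻ v in Ioc 0 (t : ℝ), extIntensity μ Φ (N ω) v) ∂P).toReal := by
  have hpop := ((hN.measurable_population (μ := μ) hΦ.measurable t).mono (hN.history.le t)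
    le_rfl).aemeasurable (μ := P)
  have hcomp := hN.aemeasurable_compensator hμ hΦ t
  unfold compensatedPopulation
  rw [integral_sub (hN.integrable_population hΦ t).integrableOn
    (hN.integrable_integral_selfIntensity hμ hΦ t).integrableOn,
    ← integral_congr_ae (ae_restrict_of_ae (hN.ae_integral_selfIntensity hμ hΦ t)),
    integral_toReal hpop.restrict (ae_restrict_of_ae
      (ae_lt_top' hpop (hN.lintegral_population_ne_top hΦ t))),
    integral_toReal hcomp.restrict (ae_restrict_of_ae (ae_lt_top' hcomp (by
      rw [hN.lintegral_compensator hΦ.measurable]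
      exact hN.lintegral_population_ne_top hΦ t)))]

theorem setIntegral_compensatedPopulation_eq (hN : IsPoissonRandomMeasure P N) (hμ : 0 ≤ μ)
    (hΦ : IsSubcriticalKernel Φ) {s t : ℝ≥0} (hst : s ≤ t) {A : Set Ω}
    (hA : MeasurableSet[hN.history s] A) :
    ∫ ω in A, compensatedPopulation μ Φ (N ω) s ∂P =
      ∫ ω in A, compensatedPopulation μ Φ (N ω) t ∂P := by
  rw [hN.setIntegral_compensatedPopulation hμ hΦ, hN.setIntegral_compensatedPopulation hμ hΦ]
  have hX : ∫⁻ ω in A, population μ Φ (N ω) t ∂P = ∫⁻ ω in A, population μ Φ (N ω) s ∂P +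
      ∫⁻ ω in A, populationMeasure μ Φ (N ω) (Ioc (s : ℝ) t) ∂P := by
    rw [← lintegral_add_left
      ((hN.measurable_population hΦ.measurable s).mono (hN.history.le s) le_rfl)]
    exact lintegral_congr fun ω => population_add _ _ _ hst
  have hL : ∫⁻ ω in A, (∫⁻ v in Ioc 0 (t : ℝ), extIntensity μ Φ (N ω) v) ∂P =
      ∫⁻ ω in A, (∫⁻ v in Ioc 0 (s : ℝ), extIntensity μ Φ (N ω) v) ∂P +
      ∫⁻ ω in A, (∫⁻ v in Ioc (s : ℝ) t, extIntensity μ Φ (N ω) v) ∂P := by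
    rw [← lintegral_add_left' (hN.aemeasurable_compensator hμ hΦ s).restrict]
    refine lintegral_congr fun ω => ?_
    rw [← lintegral_union measurableSet_Ioc
      (Set.disjoint_left.2 fun x hx hx' => not_lt.2 hx.2 hx'.1),
      Ioc_union_Ioc_eq_Ioc s.coe_nonneg (NNReal.coe_le_coe.2 hst)]
  have hXt : ∫⁻ ω in A, population μ Φ (N ω) t ∂P ≠ ∞ :=
    ((setLIntegral_le_lintegral _ _).trans_lt (hN.lintegral_population_ne_top hΦ t).lt_top).ne
  have hLt : ∫⁻ ω in A, (∫⁻ v in Ioc 0 (t : ℝ), extIntensity μ Φ (N ω) v) ∂P ≠ ∞ := by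
    refine ((setLIntegral_le_lintegral _ _).trans_lt ?_).ne
    rw [hN.lintegral_compensator hΦ.measurable]
    exact (hN.lintegral_population_ne_top hΦ t).lt_top
  -- The increments over `(s, t]` now appear as the same finite number in both terms, and cancel.
  rw [← hN.setLIntegral_populationMeasure hΦ.measurable t hA] at hL
  rw [hX] at hXt ⊢
  rw [hL] at hLt ⊢
  rw [ENNReal.toReal_add (ENNReal.add_ne_top.1 hXt).1 (ENNReal.add_ne_top.1 hXt).2,
    ENNReal.toReal_add (ENNReal.add_ne_top.1 hLt).1 (ENNReal.add_ne_top.1 hLt).2]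
  ring

/-- The compensated population is a martingale for the history of `N`. -/
theorem martingale_compensatedPopulation (hN : IsPoissonRandomMeasure P N) (hμ : 0 ≤ μ)
    (hΦ : IsSubcriticalKernel Φ) :
    Martingale (fun (t : ℝ≥0) ω => compensatedPopulation μ Φ (N ω) t) hN.history P := by
  have hint : ∀ t : ℝ≥0, Integrable (fun ω => compensatedPopulation μ Φ (N ω) t) P := fun t =>
    (hN.integrable_population hΦ t).sub (hN.integrable_integral_selfIntensity hμ hΦ t)
  have hadapt : StronglyAdapted hN.history fun (t : ℝ≥0) ω => compensatedPopulation μ Φ (N ω) t :=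
    fun t => (hN.stronglyAdapted_compensatedPopulation hΦ t).mono
      (hN.populationHistory_le hΦ.measurable t)
  refine ⟨hadapt, fun s t hst => ?_⟩
  exact (ae_eq_condExp_of_forall_setIntegral_eq (hN.history.le s) (hint t)
    (fun A _ _ => (hint s).integrableOn)
    (fun A hA _ => hN.setIntegral_compensatedPopulation_eq hμ hΦ hst hA)
    (hadapt s).aestronglyMeasurable).symm

end IsPoissonRandomMeasure

/-- A martingale is a martingale for any smaller filtration to which it is adapted. -/
theorem MeasureTheory.Martingale.of_le {Ω ι : Type*} [Preorder ι] {mΩ : MeasurableSpace Ω}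
    {P : Measure Ω} [IsFiniteMeasure P] {𝓕 𝓖 : Filtration ι mΩ} {M : ι → Ω → ℝ}
    (hM : Martingale M 𝓕 P) (hle : 𝓖 ≤ 𝓕) (hadapt : StronglyAdapted 𝓖 M) :
    Martingale M 𝓖 P := by
  refine ⟨hadapt, fun s t hst => ?_⟩
  calc P[M t | 𝓖 s] =ᵐ[P] P[P[M t | 𝓕 s] | 𝓖 s] :=
        (condExp_condExp_of_le (hle s) (𝓕.le s)).symm
    _ =ᵐ[P] P[M s | 𝓖 s] := condExp_congr_ae (hM.condExp_ae_eq hst)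
    _ = M s := condExp_of_stronglyMeasurable (𝓖.le s) (hadapt s) (hM.integrable s)

/-! ### Jumps of size at least two -/

section Jump

variable {m : Measure (ℝ × ℝ)} {μ : ℝ} {Φ : ℝ → ℝ}

theorem lineage_one_le_of_le {Ψ : ℝ → ℝ} (h : ∀ s, Ψ s ≤ Φ s) (x : ℝ × ℝ) :
    lineage μ Ψ m 1 x ≤ lineage μ Φ m 1 x := by
  refine lintegral_mono fun y => ?_
  gcongr
  · exact h _
  · exact le_rfl

/-- An immigrant whose mark also makes it the child of an immigrant produces a jump of size two. -/
theorem IsConfiguration.two_le_populationMeasure_singleton (hm : IsConfiguration m)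
    (hΦ : Measurable Φ)
    (h : ∫⁻ x in Ioi 0 ×ˢ Ici 0, lineage μ (fun s => min μ (Φ s)) m 1 x ∂m ≠ 0) :
    ∃ t : ℝ, 0 < t ∧ 2 ≤ populationMeasure μ Φ m {t} := by
  have := hm.sFinite
  obtain ⟨S, hS⟩ := hm.exists_tsum
  rw [hS _ _ (measurableSet_Ioi.prod measurableSet_Ici), Ne, ENNReal.tsum_eq_zero] at h
  push Not at h
  obtain ⟨x, hx⟩ := h
  have hxm := mem_of_indicator_ne_zero hx
  rw [indicator_of_mem hxm] at hx
  -- The kernel `min μ Φ` accepts only marks below `μ`, so a child for this kernel is itself an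
  -- immigrant.
  have hxμ : (x : ℝ × ℝ).2 ≤ μ := by
    by_contra hxμ
    refine hx ((lintegral_congr fun y => ?_).trans lintegral_zero)
    rw [indicator_of_notMem, zero_mul]
    exact fun h => hxμ (le_trans h (min_le_left _ _))
  have h0 : lineage μ Φ m 0 x = 1 := indicator_of_mem (s := {x : ℝ × ℝ | x.2 ≤ μ}) hxμ 1
  have h1 : 1 ≤ lineage μ Φ m 1 x := (hm.isNatOrTop_lineage 1 x).one_le fun h =>
    hx (nonpos_iff_eq_zero.1 ((lineage_one_le_of_le (fun s => min_le_right _ _) _).trans h.le))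
  refine ⟨(x : ℝ × ℝ).1, hxm.1, ?_⟩
  have hk : ∀ k, lineage μ Φ m k x ≤
      ∫⁻ y in {(x : ℝ × ℝ).1} ×ˢ Ici 0, lineage μ Φ m k y ∂m := by
    intro k
    rw [hS _ _ ((measurableSet_singleton _).prod measurableSet_Ici)]
    refine le_trans (le_of_eq ?_) (ENNReal.le_tsum x)
    rw [indicator_of_mem (show (x : ℝ × ℝ) ∈ {(x : ℝ × ℝ).1} ×ˢ Ici (0 : ℝ) from ⟨rfl, hxm.2⟩)]
  rw [populationMeasure_apply hΦ (measurableSet_singleton _) (singleton_subset_iff.2 hxm.1)]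
  calc (2 : ℝ≥0∞) = 1 + 1 := one_add_one_eq_two.symm
    _ ≤ lineage μ Φ m 0 x + lineage μ Φ m 1 x := by rw [h0]; gcongr
    _ = ∑ k ∈ Finset.range 2, lineage μ Φ m k x := by simp [Finset.sum_range_succ]
    _ ≤ ∑ k ∈ Finset.range 2, ∫⁻ y in {(x : ℝ × ℝ).1} ×ˢ Ici 0, lineage μ Φ m k y ∂m :=
        Finset.sum_le_sum fun k _ => hk k
    _ ≤ _ := ENNReal.sum_le_tsum _

/-- For `s < t` the sets `(0, s]` and `{t}` are disjoint in `(0, t]`. Finiteness of the population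
keeps the passage to real values monotone. -/
theorem leftLim_add_two_le (h : ∀ t : ℝ≥0, population μ Φ m t ≠ ∞) {t : ℝ} (ht : 0 < t)
    (h2 : 2 ≤ populationMeasure μ Φ m {t}) :
    Function.leftLim (fun s : ℝ≥0 => (population μ Φ m s).toReal) t.toNNReal + 2 ≤
      (population μ Φ m t.toNNReal).toReal := by
  have hmono : Monotone fun s : ℝ≥0 => (population μ Φ m s).toReal := fun s r hsr =>
    ENNReal.toReal_mono (h r) (monotone_population (NNReal.coe_le_coe.2 hsr))
  have hpos : (0 : ℝ≥0) < t.toNNReal := Real.toNNReal_pos.2 ht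
  have hne : (𝓝[<] t.toNNReal).NeBot := nhdsLT_neBot_of_exists_lt ⟨0, hpos⟩
  rw [← le_sub_iff_add_le]
  refine le_of_tendsto (hmono.tendsto_leftLim _) ?_
  filter_upwards [self_mem_nhdsWithin] with s hs
  have hst : (s : ℝ) < t := Real.lt_toNNReal_iff_coe_lt.1 hs
  rw [le_sub_iff_add_le, ← ENNReal.toReal_ofNat 2, ← ENNReal.toReal_add (h s) (by simp)]
  refine ENNReal.toReal_mono (h _) ?_
  rw [← populationMeasure_Ioc, ← populationMeasure_Ioc, Real.coe_toNNReal _ ht.le]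
  refine (add_le_add_right h2 _).trans ?_
  rw [← measure_union (by simp [hst.not_ge]) (measurableSet_singleton t)]
  refine measure_mono (union_subset (Ioc_subset_Ioc_right hst.le) ?_)
  exact singleton_subset_iff.2 ⟨ht, le_rfl⟩

end Jump

namespace IsPoissonRandomMeasure

variable {Ω : Type*} {mΩ : MeasurableSpace Ω} {P : Measure Ω} [IsProbabilityMeasure P]
  {N : Ω → Measure (ℝ × ℝ)} {μ : ℝ} {Φ : ℝ → ℝ}

/-- If there are almost surely no second generation individuals, then the kernel vanishes. -/
theorem kernel_eq_zero_of_second_generation (hN : IsPoissonRandomMeasure P N) (hμ : 0 < μ)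
    (hΦ : Measurable Φ)
    (h : ∀ᵐ ω ∂P, ∫⁻ x in Ioi 0 ×ˢ Ici 0, lineage μ Φ (N ω) 1 x ∂(N ω) = 0) :
    ∫⁻ s in Ioi 0, ENNReal.ofReal (Φ s) = 0 := by
  have hsf : ∀ ω, SFinite (N ω) := fun ω => (hN.configuration ω).sFinite
  have h1 : ∀ ω, ∫⁻ x in Ioi 0 ×ˢ Ici 0, lineage μ Φ (N ω) 1 x =
      (∫⁻ s in Ioi 0, ENNReal.ofReal (Φ s)) *
        ∫⁻ x in Ioi 0 ×ˢ Ici 0, lineage μ Φ (N ω) 0 x ∂(N ω) := by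
    intro ω
    rw [lintegral_volume_prod_Ici (measurable_lineage hΦ _),
      ← generationMeasure_apply hΦ 0 measurableSet_Ioi subset_rfl,
      ← lintegral_Ioo_sub_eq _ hΦ.ennreal_ofReal]
    exact lintegral_congr fun v => lintegral_lineage_succ hΦ 0 v
  -- Immigrants arrive at rate `μ > 0` on an infinite time axis, so their mean number is infinite.
  have h2 : ∀ ω, ∫⁻ x in Ioi 0 ×ˢ Ici 0, lineage μ Φ (N ω) 0 x = ∞ := by
    intro ω
    rw [lintegral_volume_prod_Ici (measurable_lineage hΦ _)]
    simp [lintegral_lineage_zero, ENNReal.mul_top, hμ]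
  have h3 := hN.setLIntegral_lineage (μ := μ) hΦ 1 measurableSet_Ioi subset_rfl
  have h4 := hN.setLIntegral_lineage (μ := μ) hΦ 0 measurableSet_Ioi subset_rfl
  simp_rw [h1] at h3
  simp_rw [h2] at h4
  rw [lintegral_congr_ae h, lintegral_zero] at h3
  by_contra hK
  have h5 : ∫⁻ ω, (∫⁻ x in Ioi 0 ×ˢ Ici 0, lineage μ Φ (N ω) 0 x ∂(N ω)) ∂P = 0 := by
    refine le_antisymm ?_ zero_le
    -- The inequality form needs no measurability of the number of immigrants. A nonzero mass would
    -- make their mean number zero, contradicting `h4`.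
    have := lintegral_const_mul_le (μ := P) (∫⁻ s in Ioi 0, ENNReal.ofReal (Φ s))
      fun ω => ∫⁻ x in Ioi 0 ×ˢ Ici 0, lineage μ Φ (N ω) 0 x ∂(N ω)
    rw [← h3] at this
    exact le_of_eq ((mul_eq_zero.1 (nonpos_iff_eq_zero.1 this)).resolve_left hK)
  rw [h5] at h4
  simp at h4

/-- The criterion for a vanishing kernel is applied to `min μ Φ`: without jumps of size two its
second generation is almost surely empty. As `μ > 0`, the vanishing of the minimum is that of `Φ`.
-/
theorem measure_jump_pos (hN : IsPoissonRandomMeasure P N) (hμ : 0 < μ)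
    (hΦ : IsSubcriticalKernel Φ)
    (h0 : ¬ ∀ᵐ s ∂(volume.restrict (Ici (0 : ℝ))), Φ s = 0) :
    0 < P {ω | ∃ t : ℝ≥0,
      Function.leftLim (fun s : ℝ≥0 => (population μ Φ (N ω) s).toReal) t + 2 ≤
        (population μ Φ (N ω) t).toReal} := by
  by_contra hP
  have hP : ∀ᵐ ω ∂P, ¬ ∃ t : ℝ≥0,
      Function.leftLim (fun s : ℝ≥0 => (population μ Φ (N ω) s).toReal) t + 2 ≤
        (population μ Φ (N ω) t).toReal := by
    rw [ae_iff]
    simpa using hP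
  have hΨ : Measurable fun s => min μ (Φ s) := measurable_const.min hΦ.measurable
  have hzero := hN.kernel_eq_zero_of_second_generation hμ hΨ (by
    filter_upwards [hP, hN.ae_population_ne_top (μ := μ) hΦ] with ω hω hfin
    by_contra hne
    obtain ⟨t, ht, h2⟩ :=
      (hN.configuration ω).two_le_populationMeasure_singleton hΦ.measurable hne
    exact hω ⟨t.toNNReal, leftLim_add_two_le hfin ht h2⟩)
  rw [lintegral_eq_zero_iff hΨ.ennreal_ofReal, restrict_Ioi_eq_restrict_Ici] at hzero
  refine h0 ?_
  filter_upwards [hzero, ae_restrict_mem measurableSet_Ici] with s hs hs0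
  have := ENNReal.ofReal_eq_zero.1 hs
  exact le_antisymm ((min_le_iff.1 this).resolve_left hμ.not_ge) (hΦ.nonneg s hs0)

end IsPoissonRandomMeasure

/-! ### The six assertions -/

theorem mainTheorem4 {Ω : Type*} [mΩ : MeasurableSpace Ω] (P : Measure Ω) [IsProbabilityMeasure P]
    (N : Ω → Measure (ℝ × ℝ)) (hN : IsPoissonRandomMeasure P N)
    (μ : ℝ) (hμ : 0 < μ) (Φ : ℝ → ℝ) (hΦ : IsSubcriticalKernel Φ) :
    -- the series defining `X` converges, uniformly on compact time intervals, in mean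
    (∀ T : ℝ≥0, Tendsto
      (fun p : ℕ => ∫⁻ ω, ⨆ t ∈ Icc 0 T,
        ‖(population μ Φ (N ω) t).toReal -
          ∑ k ∈ Finset.range p, (generation μ Φ (N ω) k t).toReal‖ₑ ∂P)
      atTop (𝓝 0)) ∧
    -- `X` is `ℕ`-valued, non-decreasing and piecewise constant
    (∀ᵐ ω ∂P, (∀ t : ℝ≥0, ∃ k : ℕ, population μ Φ (N ω) t = k) ∧
      Monotone (fun t : ℝ≥0 => population μ Φ (N ω) t) ∧
      IsPiecewiseConstant (fun t : ℝ≥0 => population μ Φ (N ω) t)) ∧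
    -- `ℓ` is given by a convergent integral and is locally integrable
    (∀ᵐ ω ∂P, ∀ t : ℝ≥0,
      IntegrableOn (fun r => Φ (t - r)) (Ioo 0 (t : ℝ)) (populationMeasure μ Φ (N ω)) ∧
      selfIntensity μ Φ (N ω) t =
        μ + ∫ r in Ioo 0 (t : ℝ), Φ (t - r) ∂(populationMeasure μ Φ (N ω)) ∧
      IntegrableOn (selfIntensity μ Φ (N ω)) (Ioo 0 (t : ℝ))) ∧
    -- `M` is a martingale for the history of `N`
    Martingale (fun (t : ℝ≥0) ω => compensatedPopulation μ Φ (N ω) t)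
      (poissonHistory N hN.measurable_count) P ∧
    -- the history of `X` is a filtration smaller than that of `N`, for which `ℓ` is predictable
    -- and `M` is a martingale
    (∃ FX : Filtration ℝ≥0 mΩ,
      (∀ t : ℝ≥0, FX t = ⨆ (s : ℝ≥0) (_ : s ≤ t),
        MeasurableSpace.comap (fun ω => population μ Φ (N ω) s) inferInstance) ∧
      FX ≤ poissonHistory N hN.measurable_count ∧
      IsStronglyPredictable FX (fun (t : ℝ≥0) ω => selfIntensity μ Φ (N ω) t) ∧
      Martingale (fun (t : ℝ≥0) ω => compensatedPopulation μ Φ (N ω) t) FX P) ∧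
    -- unless `Φ` vanishes, `X` has a jump of size at least two with positive probability
    (¬ (∀ᵐ s ∂(volume.restrict (Ici (0 : ℝ))), Φ s = 0) →
      0 < P {ω | ∃ t : ℝ≥0,
        Function.leftLim (fun s : ℝ≥0 => (population μ Φ (N ω) s).toReal) t + 2 ≤
          (population μ Φ (N ω) t).toReal}) := by
  have hfin := hN.ae_population_ne_top (μ := μ) hΦ
  refine ⟨hN.tendsto_lintegral_iSup_population_sub hΦ, ?_, ?_,
    hN.martingale_compensatedPopulation hμ.le hΦ, ?_, hN.measure_jump_pos hμ hΦ⟩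
  · filter_upwards [hfin] with ω hω
    have hm := hN.configuration ω
    exact ⟨fun t => (hm.isNatOrTop_population t).resolve_left (hω t),
      fun s t hst => monotone_population (NNReal.coe_le_coe.2 hst),
      hm.isPiecewiseConstant_population hΦ.measurable hω⟩
  · filter_upwards [hfin] with ω hω t
    have hm := hN.configuration ω
    have hIoo := populationMeasure_Ioo_ne_top hω t
    exact ⟨hm.integrableOn_populationMeasure hΦ.measurable measurableSet_Ioo (fun x hx => hx.1) hIoo
      (hΦ.measurable.comp (measurable_const.sub measurable_id)), if_neg hIoo,
      integrableOn_selfIntensity hm hμ.le hΦ hω t⟩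
  · have hle := hN.populationHistory_le (μ := μ) hΦ.measurable
    exact ⟨hN.populationHistory μ hΦ.measurable, fun t => rfl, hle,
      hN.isStronglyPredictable_selfIntensity hΦ,
      (hN.martingale_compensatedPopulation hμ.le hΦ).of_le hle
        (hN.stronglyAdapted_compensatedPopulation hΦ)⟩
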